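/- **Notation.** Let $D=-i\nabla$, $\langle D\rangle=(1+|D|^2)^{1/2}$, $\|f\|_{H^s}=\|\langle D\rangle^s f\|_{L^2}$, and let $K=\sqrt{\tanh|D|/|D|}$ (a Fourier multiplier, with $K(0)=1$). All functions are real-valued. *One dimension.* Let $X^s=H^s(\mathbb R)\times H^{s+1/2}(\mathbb R)$ with $\|(\eta,v)\|_{X^s}^2=\|\eta\|_{H^s}^2+\|K^{-1}v\|_{H^s}^2$, let $m(D)=\sqrt{D\tanh D}\,\mathrm{sgn}\,D$, $$\mathcal K=\tfrac1{\sqrt2}\begin{pmatrix}1&1\\K&-K\end{pmatrix},\qquad \mathcal S(t)=\mathcal K\begin{pmatrix}e^{-itm(D)}&0\\0&e^{itm(D)}\end{pmatrix}\mathcal K^{-1},$$ and, for $u=(\eta,v)$, $$\mathcal A(u;u_0)(t)=\mathcal S(t)u_0+\int_0^t\mathcal S(t-t')\,(-i\tanh D)\begin{pmatrix}\eta v\\ v^2/2\end{pmatrix}(t')\,dt'.$$ *Two dimensions.* Let $X^s$ be the space of $(\eta,\mathbf v)\in H^s(\mathbb R^2)\times H^{s+1/2}(\mathbb R^2)^2$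 with $\nabla\times\mathbf v=0$ and norm $\|(\eta,\mathbf v)\|_{X^s}=\|\mathcal K^{-1}(\eta,\mathbf v)\|_{H^s\times H^s}$, i.e. $\|(\eta,\mathbf v)\|_{X^s}^2=\|\eta\|_{H^s}^2+\|K^{-1}\mathbf v\|_{H^s}^2$. Here $m(D)=|D|K$, $R_j=\partial_j/|D|$, $$\mathcal K=\tfrac1{\sqrt2}\begin{pmatrix}1&1\\-iKR_1&iKR_1\\-iKR_2&iKR_2\end{pmatrix},$$ $\mathcal S(t)$ is defined from $\mathcal K$ and $m$ as before, and $$\mathcal A(u;u_0)(t)=\mathcal S(t)u_0-\int_0^t\mathcal S(t-t')\begin{pmatrix}K^2\nabla\cdot(\eta\mathbf v)\\K^2\nabla(|\mathbf v|^2/2)\end{pmatrix}(t')\,dt'.$$ In both cases $X^s_T=C([0,T];X^s)$ with the supremum norm. **Statement.** Let $s>0$ in one dimension, or $s>1/2$ in two dimensions. 0. For every $T>0$ and $u_0\in X^s$, $\mathcal A(\cdot\,;u_0)$ is a well-defined map $X^s_T\to X^s_T$. 1. There is a constant $C_s>0$ depending only on $s$ (and the dimension) such that for every $u_0\in X^s$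 and every $T>0$ with $7C_s\|u_0\|_{X^s}T\le1$ (in particular for $T=(7C_s\|u_0\|_{X^s})^{-1}$ if $u_0\ne0$) the equation $u=\mathcal A(u;u_0)$ has a unique solution $u\in X^s_T$. 2. For every $R>0$ there is $T=T(R)>0$ such that for every $u_0$ in the open ball $B_R(0)\subset X^s$ the equation $u=\mathcal A(u;u_0)$ has a unique solution in $X^s_T$, and the flow map $u_0\mapsto u$ is a real analytic mapping of $B_R(0)$ to $X^s_T$. -/

import Mathlib

open MeasureTheory FourierTransform
open scoped SchwartzMap NNReal Real

namespace WhithamBoussinesq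
noncomputable section
section
set_option linter.unusedSectionVars false

variable {V : Type} [NormedAddCommGroup V] [InnerProductSpace ℝ V] [FiniteDimensional ℝ V]
  [MeasurableSpace V] [BorelSpace V]

/-- The power `⟨ω⟩ ^ s = (1 + |ω|²) ^ (s / 2)` of the Japanese bracket. -/
def bracket (s : ℝ) (ω : V) : ℝ := (1 + ‖ω‖ ^ 2) ^ (s / 2)

/-- The symbol `K(ω) = √(tanh |ω| / |ω|)`, continuously extended by `K(0) = 1`. -/
def symK (ω : V) : ℝ := if ‖ω‖ = 0 then 1 else √(Real.tanh ‖ω‖ / ‖ω‖)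

theorem bracket_pos (s : ℝ) (ω : V) : 0 < bracket s ω := by
  unfold bracket; positivity

theorem bracket_add (s t : ℝ) (ω : V) : bracket (s + t) ω = bracket s ω * bracket t ω := by
  unfold bracket; rw [← Real.rpow_add (by positivity)]; congr 1; ring

theorem one_le_bracket {s : ℝ} (hs : 0 ≤ s) (ω : V) : 1 ≤ bracket s ω := by
  unfold bracket
  exact Real.one_le_rpow (by nlinarith [sq_nonneg ‖ω‖]) (by positivity)

theorem bracket_neg (s : ℝ) (ω : V) : bracket s (-ω) = bracket s ω := by simp [bracket]

theorem symK_neg (ω : V) : symK (-ω) = symK ω := by simp only [symK, norm_neg]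

theorem tanh_le_self {x : ℝ} (hx : 0 ≤ x) : Real.tanh x ≤ x := by
  rw [Real.tanh_eq_sinh_div_cosh, div_le_iff₀ (Real.cosh_pos x)]
  have hmono : MonotoneOn (fun x : ℝ => x * Real.cosh x - Real.sinh x) (Set.Ici 0) := by
    apply monotoneOn_of_deriv_nonneg (convex_Ici 0)
    · fun_prop
    · fun_prop
    · intro y hy
      simp only [interior_Ici, Set.mem_Ioi] at hy
      have h : HasDerivAt (fun x : ℝ => x * Real.cosh x - Real.sinh x)
          (1 * Real.cosh y + y * Real.sinh y - Real.cosh y) y :=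
        ((hasDerivAt_id y).mul (Real.hasDerivAt_cosh y)).sub (Real.hasDerivAt_sinh y)
      rw [h.deriv]
      nlinarith [mul_nonneg hy.le (Real.sinh_nonneg_iff.2 hy.le)]
  have := hmono (Set.self_mem_Ici) (Set.mem_Ici.2 hx) hx
  simp at this
  linarith

theorem le_tanh {x : ℝ} (_hx : 0 ≤ x) : x ≤ (1 + x) * Real.tanh x := by
  rw [Real.tanh_eq_sinh_div_cosh, mul_div_assoc', le_div_iff₀ (Real.cosh_pos x),
    Real.sinh_eq, Real.cosh_eq]
  have h1 : Real.exp (-x) * Real.exp x = 1 := by rw [← Real.exp_add]; simp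
  have h2 : 1 + 2 * x ≤ Real.exp x * Real.exp x := by
    rw [← Real.exp_add]; linarith [Real.add_one_le_exp (x + x)]
  have h3 := Real.exp_pos (-x)
  have h5 := Real.exp_pos x
  nlinarith [mul_le_mul_of_nonneg_left h2 h3.le]

theorem symK_pos (ω : V) : 0 < symK ω := by
  unfold symK
  split_ifs with h
  · exact one_pos
  · have hn : 0 < ‖ω‖ := lt_of_le_of_ne (norm_nonneg ω) (Ne.symm h)
    have := le_tanh hn.le
    have : 0 < Real.tanh ‖ω‖ := by
      by_contra hc
      nlinarith
    positivity

theorem bracket_half_sq (ω : V) : bracket (1 / 2) ω ^ 2 = √(1 + ‖ω‖ ^ 2) := by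
  unfold bracket
  rw [← Real.rpow_natCast, ← Real.rpow_mul (by positivity), Real.sqrt_eq_rpow]
  norm_num

theorem one_add_norm_le (ω : V) : 1 + ‖ω‖ ≤ 2 * bracket (1 / 2) ω ^ 2 := by
  rw [bracket_half_sq]
  have h1 : 1 ≤ √(1 + ‖ω‖ ^ 2) := Real.one_le_sqrt.2 (by nlinarith [sq_nonneg ‖ω‖])
  have h2 : ‖ω‖ ≤ √(1 + ‖ω‖ ^ 2) := Real.le_sqrt_of_sq_le (by linarith)
  linarith

theorem symK_mul_bracket_le (ω : V) : symK ω * bracket (1 / 2) ω ≤ 2 := by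
  have hb := bracket_pos (1 / 2) ω
  apply abs_le_of_sq_le_sq' _ (by norm_num) |>.2
  rw [mul_pow, bracket_half_sq]
  unfold symK
  split_ifs with h
  · simp [h]
  have hn : 0 < ‖ω‖ := lt_of_le_of_ne (norm_nonneg ω) (Ne.symm h)
  have ht1 : Real.tanh ‖ω‖ ≤ 1 := (Real.tanh_lt_one _).le
  have ht2 := tanh_le_self hn.le
  have ht0 : 0 ≤ Real.tanh ‖ω‖ := by
    by_contra hc
    nlinarith [le_tanh hn.le]
  rw [Real.sq_sqrt (by positivity), div_mul_eq_mul_div, div_le_iff₀ hn]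
  have : √(1 + ‖ω‖ ^ 2) ≤ 1 + ‖ω‖ := by
    rw [Real.sqrt_le_left (by positivity)]; nlinarith
  nlinarith [mul_le_mul_of_nonneg_left this ht0]

theorem inv_symK_le (ω : V) : (symK ω)⁻¹ ≤ 2 * bracket (1 / 2) ω := by
  have hb := bracket_pos (1 / 2) ω
  have hK := symK_pos ω
  rw [inv_le_comm₀ hK (by positivity)]
  apply abs_le_of_sq_le_sq' _ hK.le |>.2
  unfold symK
  split_ifs with h
  · have := one_le_bracket (s := 1 / 2) (by norm_num) ω
    rw [inv_pow]
    apply (inv_le_one₀ (by positivity)).2 _ |>.trans (by norm_num)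
    nlinarith
  have hn : 0 < ‖ω‖ := lt_of_le_of_ne (norm_nonneg ω) (Ne.symm h)
  have h1 := le_tanh hn.le
  have ht0 : 0 ≤ Real.tanh ‖ω‖ := by
    by_contra hc
    nlinarith
  rw [Real.sq_sqrt (by positivity), inv_pow, le_div_iff₀ hn, inv_mul_le_iff₀ (by positivity)]
  nlinarith [one_add_norm_le ω, mul_le_mul_of_nonneg_right (one_add_norm_le ω) ht0, sq_nonneg (bracket (1 / 2) ω), mul_nonneg ht0 (sq_nonneg (bracket (1 / 2) ω))]

theorem measurable_bracket (s : ℝ) : Measurable (bracket s : V → ℝ) := by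
  unfold bracket; fun_prop

theorem measurable_symK : Measurable (symK : V → ℝ) := by
  unfold symK
  apply Measurable.ite (measurableSet_eq_fun measurable_norm measurable_const) measurable_const
  have : Measurable Real.tanh := by
    have : Real.tanh = fun x => Real.sinh x / Real.cosh x := by
      ext x; exact Real.tanh_eq_sinh_div_cosh x
    rw [this]; fun_prop
  fun_prop

theorem memSobolev_iff_memLp_aux {s : ℝ} (hs : 0 ≤ s) (f : Lp ℂ 2 (volume : Measure V)) :
    TemperedDistribution.MemSobolev s 2 (f : 𝓢'(V, ℂ)) ↔
      MemLp (fun ξ : V => ((bracket s ξ : ℝ) : ℂ) * (𝓕 f) ξ) 2 volume := by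
  rw [TemperedDistribution.memSobolev_iff_exists_smulLeftCLM_fourier,
    Lp.fourier_toTemperedDistribution_eq]
  have hgr : ∀ r : ℝ, (fun x : V => (((1 + ‖x‖ ^ 2) ^ (r / 2) : ℝ) : ℂ)).HasTemperateGrowth := by
    intro r; fun_prop
  have hb : MemLp (fun x : V => (((1 + ‖x‖ ^ 2) ^ (-s / 2) : ℝ) : ℂ)) ⊤ volume := by
    refine memLp_top_of_bound (hgr (-s)).1.continuous.aestronglyMeasurable 1 (.of_forall fun x => ?_)
    rw [Complex.norm_real, Real.norm_eq_abs, abs_of_nonneg (by positivity)]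
    exact Real.rpow_le_one_of_one_le_of_nonpos (by simp) (by linarith)
  have key : ∀ f' : Lp ℂ 2 (volume : Measure V),
      TemperedDistribution.smulLeftCLM ℂ (fun x : V => (((1 + ‖x‖ ^ 2) ^ (s / 2) : ℝ) : ℂ))
        ((𝓕 f : Lp ℂ 2 (volume : Measure V)) : 𝓢'(V, ℂ)) = f' ↔
      (f' : V → ℂ) =ᵐ[volume] fun ξ : V => ((bracket s ξ : ℝ) : ℂ) * (𝓕 f) ξ := by
    intro f'
    have h1 : TemperedDistribution.smulLeftCLM ℂ
          (fun x : V => (((1 + ‖x‖ ^ 2) ^ (s / 2) : ℝ) : ℂ))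
          ((𝓕 f : Lp ℂ 2 (volume : Measure V)) : 𝓢'(V, ℂ)) = f' ↔
        TemperedDistribution.smulLeftCLM ℂ
          (fun x : V => (((1 + ‖x‖ ^ 2) ^ (-s / 2) : ℝ) : ℂ)) (f' : 𝓢'(V, ℂ)) =
          ((𝓕 f : Lp ℂ 2 (volume : Measure V)) : 𝓢'(V, ℂ)) := by
      have e1 : ((fun x : V => (((1 + ‖x‖ ^ 2) ^ (s / 2) : ℝ) : ℂ)) *
          fun x : V => (((1 + ‖x‖ ^ 2) ^ (-s / 2) : ℝ) : ℂ)) = fun _ => 1 := by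
        ext x
        simp only [Pi.mul_apply]
        rw [← Complex.ofReal_mul, ← Real.rpow_add (by positivity)]
        simp [neg_div]
      have e1' := (mul_comm _ _).trans e1
      constructor
      · intro h
        rw [← h, TemperedDistribution.smulLeftCLM_smulLeftCLM_apply (hgr _) (hgr _), e1]
        simp
      · intro h
        rw [← h, TemperedDistribution.smulLeftCLM_smulLeftCLM_apply (hgr _) (hgr _), e1']
        simp
    rw [h1, ← Lp.toTemperedDistribution_smul_eq (r := 2) (hgr _) hb]
    have hinj : ∀ a b : Lp ℂ 2 (volume : Measure V),
        (a : 𝓢'(V, ℂ)) = (b : 𝓢'(V, ℂ)) → a = b := by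
      intro a b hab
      have hk := Lp.ker_toTemperedDistributionCLM_eq_bot (F := ℂ) (μ := (volume : Measure V)) (p := 2)
      exact LinearMap.ker_eq_bot.1 hk hab
    constructor
    · intro h
      have h2 := hinj _ _ h
      have h3 := Lp.coeFn_lpSMul (r := 2) (hb.toLp _) f'
      rw [h2] at h3
      filter_upwards [h3, hb.coeFn_toLp] with x hx hy
      rw [hx]
      simp only [Pi.smul_apply', hy, smul_eq_mul, bracket]
      rw [← mul_assoc, ← Complex.ofReal_mul, ← Real.rpow_add (by positivity)]
      simp [neg_div]
    · intro h
      congr 1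
      apply Lp.ext
      filter_upwards [Lp.coeFn_lpSMul (r := 2) (hb.toLp _) f', hb.coeFn_toLp, h] with x hx hy hz
      rw [hx]
      simp only [Pi.smul_apply', hy, smul_eq_mul, hz, bracket]
      rw [← mul_assoc, ← Complex.ofReal_mul, ← Real.rpow_add (by positivity)]
      simp [neg_div]
  constructor
  · rintro ⟨f', hf'⟩
    exact (Lp.memLp f').ae_eq ((key f').1 hf')
  · intro h
    exact ⟨h.toLp, (key _).2 h.coeFn_toLp⟩

theorem bracket_le_scaled {s : ℝ} (hs : 0 ≤ s) (ξ : V) :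
    bracket s ξ ≤ bracket s ((2 * Real.pi) • ξ) := by
  unfold bracket
  have hp := Real.pi_gt_three
  apply Real.rpow_le_rpow (by positivity) _ (by positivity)
  rw [norm_smul, Real.norm_eq_abs, abs_of_pos (by positivity)]
  nlinarith [sq_nonneg ‖ξ‖, mul_nonneg (sq_nonneg ‖ξ‖) (show 0 ≤ (2 * Real.pi) ^ 2 - 1 by nlinarith)]

theorem scaled_le_bracket {s : ℝ} (hs : 0 ≤ s) (ξ : V) :
    bracket s ((2 * Real.pi) • ξ) ≤ ((2 * Real.pi) ^ 2) ^ (s / 2) * bracket s ξ := by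
  unfold bracket
  have hp := Real.pi_gt_three
  rw [← Real.mul_rpow (by positivity) (by positivity)]
  apply Real.rpow_le_rpow (by positivity) _ (by positivity)
  rw [norm_smul, Real.norm_eq_abs, abs_of_pos (by positivity)]
  nlinarith

/-- An `L²` function lies in `H^s` (as a tempered distribution) iff `⟨D⟩^s f ∈ L²`,
where `D` has the symbol `2πξ` with respect to the Fourier transform used here. -/
theorem memSobolev_iff_memLp {s : ℝ} (hs : 0 ≤ s) (f : Lp ℂ 2 (volume : Measure V)) :
    TemperedDistribution.MemSobolev s 2 (f : 𝓢'(V, ℂ)) ↔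
      MemLp (fun ξ : V => ((bracket s ((2 * Real.pi) • ξ) : ℝ) : ℂ) * (𝓕 f) ξ) 2 volume := by
  rw [memSobolev_iff_memLp_aux hs]
  have hm : ∀ c : ℝ, AEStronglyMeasurable
      (fun ξ : V => ((bracket s (c • ξ) : ℝ) : ℂ) * (𝓕 f) ξ) volume := fun c =>
    (Complex.measurable_ofReal.comp ((measurable_bracket s).comp
      (measurable_const_smul c))).aestronglyMeasurable.mul (Lp.aestronglyMeasurable _)
  have hm1 := hm 1
  simp only [one_smul] at hm1
  constructor <;> intro h
  · refine h.of_le_mul (c := ((2 * Real.pi) ^ 2) ^ (s / 2)) (hm _) (.of_forall fun ξ => ?_)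
    simp only [norm_mul, Complex.norm_real, Real.norm_eq_abs, abs_of_pos (bracket_pos _ _)]
    rw [← mul_assoc]
    exact mul_le_mul_of_nonneg_right (scaled_le_bracket hs ξ) (norm_nonneg _)
  · refine h.mono hm1 (.of_forall fun ξ => ?_)
    simp only [norm_mul, Complex.norm_real, Real.norm_eq_abs, abs_of_pos (bracket_pos _ _)]
    exact mul_le_mul_of_nonneg_right (bracket_le_scaled hs ξ) (norm_nonneg _)

theorem fourier_conj_schwartz (f : 𝓢(V, ℂ)) :
    𝓕 ((Complex.conjCLE : ℂ →L[ℝ] ℂ).compLp (f.toLp 2 (volume : Measure V))) =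
      (Complex.conjCLE : ℂ →L[ℝ] ℂ).compLp (Lp.compMeasurePreserving (fun ξ : V => -ξ)
        (Measure.measurePreserving_neg volume) (𝓕 (f.toLp 2 (volume : Measure V)))) := by
  have h1 : (Complex.conjCLE : ℂ →L[ℝ] ℂ).compLp (f.toLp 2 (volume : Measure V)) =
      (f.postcompCLM (Complex.conjCLE : ℂ →L[ℝ] ℂ)).toLp 2 := by
    apply Lp.ext
    filter_upwards [(Complex.conjCLE : ℂ →L[ℝ] ℂ).coeFn_compLp (f.toLp 2 (volume : Measure V)),
      f.coeFn_toLp 2 (volume : Measure V),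
      (f.postcompCLM (Complex.conjCLE : ℂ →L[ℝ] ℂ)).coeFn_toLp 2 (volume : Measure V)]
      with x h2 h3 h4
    rw [h4, h2, h3]
    simp
  rw [h1, SchwartzMap.toLp_fourier_eq, SchwartzMap.toLp_fourier_eq]
  apply Lp.ext
  filter_upwards [(Complex.conjCLE : ℂ →L[ℝ] ℂ).coeFn_compLp
      (Lp.compMeasurePreserving (fun ξ : V => -ξ)
      (Measure.measurePreserving_neg volume) ((𝓕 f).toLp 2)),
    Lp.coeFn_compMeasurePreserving ((𝓕 f).toLp 2)
      (Measure.measurePreserving_neg (volume : Measure V)),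
    (Measure.measurePreserving_neg (volume : Measure V)).quasiMeasurePreserving.ae
      ((𝓕 f).coeFn_toLp 2 (volume : Measure V)),
    (𝓕 (f.postcompCLM (Complex.conjCLE : ℂ →L[ℝ] ℂ))).coeFn_toLp 2 (volume : Measure V)]
    with x h2 h3 h4 h5
  rw [h5, h2, h3, Function.comp_apply, h4]
  rw [SchwartzMap.fourier_coe, SchwartzMap.fourier_coe, Real.fourier_eq', Real.fourier_eq']
  simp only [ContinuousLinearEquiv.coe_coe, Complex.conjCLE_apply]
  rw [← integral_conj]
  congr 1
  ext v
  simp [← Complex.exp_conj, Complex.conj_ofNat]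

/-- Fourier transform and complex conjugation on `L²`. -/
theorem fourier_conj (f : Lp ℂ 2 (volume : Measure V)) :
    𝓕 ((Complex.conjCLE : ℂ →L[ℝ] ℂ).compLp f) =
      (Complex.conjCLE : ℂ →L[ℝ] ℂ).compLp (Lp.compMeasurePreserving (fun ξ : V => -ξ)
        (Measure.measurePreserving_neg volume) (𝓕 f)) := by
  have hstar : Continuous (fun f : Lp ℂ 2 (volume : Measure V) =>
      (Complex.conjCLE : ℂ →L[ℝ] ℂ).compLp f) :=
    ((Complex.conjCLE : ℂ →L[ℝ] ℂ).compLpL 2 (volume : Measure V)).continuous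
  refine DenseRange.induction_on
    (p := fun f : Lp ℂ 2 (volume : Measure V) => 𝓕 ((Complex.conjCLE : ℂ →L[ℝ] ℂ).compLp f) =
      (Complex.conjCLE : ℂ →L[ℝ] ℂ).compLp (Lp.compMeasurePreserving (fun ξ : V => -ξ)
        (Measure.measurePreserving_neg volume) (𝓕 f)))
    (SchwartzMap.denseRange_toLpCLM (p := 2) (F := ℂ) ENNReal.ofNat_ne_top) f ?_ ?_
  · apply isClosed_eq
    · exact (Lp.fourierTransformₗᵢ V ℂ).continuous.comp hstar
    · exact hstar.comp ((Lp.isometry_compMeasurePreserving _).continuous.comp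
        (Lp.fourierTransformₗᵢ V ℂ).continuous)
  · intro f
    exact fourier_conj_schwartz f

/-- An `L²` function is real-valued iff its Fourier transform is Hermitian. -/
theorem real_iff_hermitian (f : Lp ℂ 2 (volume : Measure V)) :
    (∀ᵐ x, (f x).im = 0) ↔ ∀ᵐ ξ, (𝓕 f) (-ξ) = (starRingEnd ℂ) ((𝓕 f) ξ) := by
  have h1 : (∀ᵐ x, (f x).im = 0) ↔ (Complex.conjCLE : ℂ →L[ℝ] ℂ).compLp f = f := by
    rw [Lp.ext_iff]
    constructor <;> intro h
    · filter_upwards [(Complex.conjCLE : ℂ →L[ℝ] ℂ).coeFn_compLp f, h] with x h2 h3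
      rw [h2]
      simpa using Complex.conj_eq_iff_im.2 h3
    · filter_upwards [(Complex.conjCLE : ℂ →L[ℝ] ℂ).coeFn_compLp f, h] with x h2 h3
      rw [h2] at h3
      exact Complex.conj_eq_iff_im.1 (by simpa using h3)
  rw [h1, ← (Lp.fourierTransformₗᵢ V ℂ).injective.eq_iff]
  change 𝓕 ((Complex.conjCLE : ℂ →L[ℝ] ℂ).compLp f) = 𝓕 f ↔ _
  rw [fourier_conj, Lp.ext_iff]
  have h2 := (Complex.conjCLE : ℂ →L[ℝ] ℂ).coeFn_compLp
        (Lp.compMeasurePreserving (fun ξ : V => -ξ)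
        (Measure.measurePreserving_neg volume) (𝓕 f))
  have h3 := Lp.coeFn_compMeasurePreserving (𝓕 f)
        (Measure.measurePreserving_neg (volume : Measure V))
  constructor <;> intro h
  · filter_upwards [h, h2, h3] with x h4 h5 h6
    rw [h5, h6] at h4
    rw [← h4]
    simp
  · filter_upwards [h, h2, h3] with x h4 h5 h6
    rw [h5, h6]
    simp [h4]

/-- Data of a Whitham–Boussinesq system in diagonal form: the dispersion symbol `m`, the symbols
`K e_j` coupling the velocity components to the diagonal variables, and the symbols `-i g_j` of
the operators acting on the quadratic nonlinearity. All symbols are functions of `ω`, the symbol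
of `D = -i∇`. -/
structure Symbols (V : Type) [NormedAddCommGroup V] [MeasurableSpace V] (ι : Type) where
  m : V → ℝ
  e : V → ι → ℝ
  g : V → ι → ℝ
  measurable_m : Measurable m
  measurable_e : ∀ j, Measurable fun ω => e ω j
  abs_e_le : ∀ ω j, |e ω j| ≤ 1
  parity : ∀ ω, (m (-ω) = -m ω ∧ ∀ j, e (-ω) j = e ω j) ∨
    (m (-ω) = m ω ∧ ∀ j, e (-ω) j = -e ω j)

variable {ι : Type} [Fintype ι]

/-- Square-integrable (complex-valued) functions. -/
abbrev L2 (V : Type) [NormedAddCommGroup V] [InnerProductSpace ℝ V] [FiniteDimensional ℝ V]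
    [MeasurableSpace V] [BorelSpace V] : Type := Lp ℂ 2 (volume : Measure V)

/-- The Fourier transform of an `L²` function as a function of `ξ`; `D` has symbol `2πξ`. -/
def hat (f : L2 V) : V → ℂ := ((𝓕 f : L2 V) : V → ℂ)

/-- Membership in `X^s`: `η ∈ H^s`, `v_j ∈ H^{s+1/2}`, all real-valued, and `v` is curl free
(`e_j v̂_k = e_k v̂_j`; this is void when there is one velocity component). -/
structure MemX (P : Symbols V ι) (s : ℝ≥0) (u : L2 V × (ι → L2 V)) : Prop where
  sobolev_eta : TemperedDistribution.MemSobolev (s : ℝ) 2 (u.1 : 𝓢'(V, ℂ))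
  sobolev_vel : ∀ j, TemperedDistribution.MemSobolev ((s : ℝ) + 1 / 2) 2 (u.2 j : 𝓢'(V, ℂ))
  real_eta : ∀ᵐ x, (u.1 x).im = 0
  real_vel : ∀ j, ∀ᵐ x, (u.2 j x).im = 0
  curl_free : ∀ j k, ∀ᵐ ξ : V,
    (P.e ((2 * π) • ξ) j : ℂ) * hat (u.2 k) ξ = (P.e ((2 * π) • ξ) k : ℂ) * hat (u.2 j) ξ

theorem hat_add (f g : L2 V) : hat (f + g) =ᵐ[volume] hat f + hat g := by
  unfold hat
  rw [FourierTransform.fourier_add]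
  exact Lp.coeFn_add _ _

theorem hat_smul (c : ℝ) (f : L2 V) : hat (c • f) =ᵐ[volume] fun ξ => (c : ℂ) * hat f ξ := by
  unfold hat
  have : c • f = (c : ℂ) • f := by
    apply Lp.ext
    filter_upwards [Lp.coeFn_smul c f, Lp.coeFn_smul (c : ℂ) f] with x h1 h2
    rw [h1, h2, Pi.smul_apply, Pi.smul_apply, Complex.real_smul, smul_eq_mul]
  rw [this, FourierTransform.fourier_smul]
  filter_upwards [Lp.coeFn_smul (c : ℂ) (𝓕 f)] with x h
  rw [h, Pi.smul_apply, smul_eq_mul]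

theorem hat_zero : hat (0 : L2 V) =ᵐ[volume] 0 := by
  filter_upwards [hat_smul 0 (0 : L2 V)] with x h
  simpa using h

theorem memSobolev_iff_hat {s : ℝ} (hs : 0 ≤ s) (f : L2 V) :
    TemperedDistribution.MemSobolev s 2 (f : 𝓢'(V, ℂ)) ↔
      MemLp (fun ξ : V => ((bracket s ((2 * π) • ξ) : ℝ) : ℂ) * hat f ξ) 2 volume :=
  memSobolev_iff_memLp hs f

theorem MemX.add {P : Symbols V ι} {s : ℝ≥0} {u w : L2 V × (ι → L2 V)} (hu : MemX P s u)
    (hw : MemX P s w) : MemX P s (u + w) := by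
  have hs : (0 : ℝ) ≤ s := s.2
  refine ⟨?_, fun j => ?_, ?_, fun j => ?_, fun j k => ?_⟩
  · have := hu.sobolev_eta.add hw.sobolev_eta
    rwa [← Lp.toTemperedDistributionCLM_apply, ← Lp.toTemperedDistributionCLM_apply,
      ← map_add] at this
  · have := (hu.sobolev_vel j).add (hw.sobolev_vel j)
    rwa [← Lp.toTemperedDistributionCLM_apply, ← Lp.toTemperedDistributionCLM_apply,
      ← map_add] at this
  · filter_upwards [hu.real_eta, hw.real_eta, Lp.coeFn_add u.1 w.1] with x h1 h2 h3
    rw [Prod.fst_add, h3, Pi.add_apply, Complex.add_im, h1, h2, add_zero]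
  · filter_upwards [hu.real_vel j, hw.real_vel j, Lp.coeFn_add (u.2 j) (w.2 j)] with x h1 h2 h3
    rw [Prod.snd_add, Pi.add_apply, h3, Pi.add_apply, Complex.add_im, h1, h2, add_zero]
  · filter_upwards [hu.curl_free j k, hw.curl_free j k, hat_add (u.2 j) (w.2 j),
      hat_add (u.2 k) (w.2 k)] with x h1 h2 h3 h4
    simp only [Prod.snd_add, Pi.add_apply] at h3 h4 ⊢
    rw [h3, h4, mul_add, mul_add, h1, h2]

theorem MemX.smul {P : Symbols V ι} {s : ℝ≥0} {u : L2 V × (ι → L2 V)} (c : ℝ)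
    (hu : MemX P s u) : MemX P s (c • u) := by
  have hs : (0 : ℝ) ≤ s := s.2
  refine ⟨?_, fun j => ?_, ?_, fun j => ?_, fun j k => ?_⟩
  · rw [memSobolev_iff_hat hs]
    refine (((memSobolev_iff_hat hs _).1 hu.sobolev_eta).const_mul (c : ℂ)).ae_eq ?_
    filter_upwards [hat_smul c u.1] with x h
    simp only [Prod.smul_fst, h]; ring
  · rw [memSobolev_iff_hat (by positivity)]
    refine (((memSobolev_iff_hat (by positivity) _).1 (hu.sobolev_vel j)).const_mul
      (c : ℂ)).ae_eq ?_
    filter_upwards [hat_smul c (u.2 j)] with x h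
    simp only [Prod.smul_snd, Pi.smul_apply, h]; ring
  · filter_upwards [hu.real_eta, Lp.coeFn_smul c u.1] with x h1 h3
    rw [Prod.smul_fst, h3, Pi.smul_apply, Complex.smul_im, h1, smul_zero]
  · filter_upwards [hu.real_vel j, Lp.coeFn_smul c (u.2 j)] with x h1 h3
    rw [Prod.smul_snd, Pi.smul_apply, h3, Pi.smul_apply, Complex.smul_im, h1, smul_zero]
  · filter_upwards [hu.curl_free j k, hat_smul c (u.2 j), hat_smul c (u.2 k)] with x h1 h3 h4
    simp only [Prod.smul_snd, Pi.smul_apply, h3, h4]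
    linear_combination (c : ℂ) * h1

theorem MemX.zero (P : Symbols V ι) (s : ℝ≥0) : MemX P s 0 := by
  have hs : (0 : ℝ) ≤ s := s.2
  have h0 : ((0 : L2 V) : 𝓢'(V, ℂ)) = 0 := by
    rw [← Lp.toTemperedDistributionCLM_apply, map_zero]
  refine ⟨?_, fun j => ?_, ?_, fun j => ?_, fun j k => ?_⟩
  · simp [h0]
  · simp [h0]
  · filter_upwards [Lp.coeFn_zero ℂ 2 (volume : Measure V)] with x h
    exact congrArg Complex.im h
  · filter_upwards [Lp.coeFn_zero ℂ 2 (volume : Measure V)] with x h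
    exact congrArg Complex.im h
  · filter_upwards [hat_zero (V := V)] with x h
    simp [h]

/-- `X^s` as a real vector space of pairs `(η, v)`. -/
def subX (P : Symbols V ι) (s : ℝ≥0) : Submodule ℝ (L2 V × (ι → L2 V)) where
  carrier := {u | MemX P s u}
  add_mem' := MemX.add
  zero_mem' := MemX.zero P s
  smul_mem' c _ := MemX.smul c

/-- The space `X^s`, which is given its own norm below. -/
def X (P : Symbols V ι) (s : ℝ≥0) : Type := subX P s

instance (P : Symbols V ι) (s : ℝ≥0) : AddCommGroup (X P s) :=
  inferInstanceAs (AddCommGroup (subX P s))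

instance (P : Symbols V ι) (s : ℝ≥0) : Module ℝ (X P s) :=
  inferInstanceAs (Module ℝ (subX P s))

section
variable {P : Symbols V ι} {s : ℝ≥0}

/-- Surface elevation. -/
def X.eta (u : X P s) : L2 V := u.1.1

/-- Components of the velocity. -/
def X.vel (u : X P s) (j : ι) : L2 V := u.1.2 j

theorem X.memX (u : X P s) : MemX P s u.1 := u.2

/-- The components `η, v_j` of `u`. -/
def X.comp (u : X P s) : Option ι → L2 V
  | none => u.eta
  | some j => u.vel j

/-- The symbols `⟨ω⟩^s` (for `η`) and `⟨ω⟩^s K(ω)⁻¹` (for `v_j`) that define the norm of `X^s`. -/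
def normWeight (s : ℝ≥0) : Option ι → V → ℝ
  | none, ω => bracket s ω
  | some _, ω => bracket s ω * (symK ω)⁻¹

theorem measurable_normWeight (o : Option ι) : Measurable (normWeight s o : V → ℝ) := by
  cases o with
  | none => exact measurable_bracket _
  | some j => exact (measurable_bracket _).mul measurable_symK.inv

theorem normWeight_pos (o : Option ι) (ω : V) : 0 < normWeight s o ω := by
  cases o with
  | none => exact bracket_pos _ _
  | some j => exact mul_pos (bracket_pos _ _) (inv_pos.2 (symK_pos _))

theorem aestronglyMeasurable_mul_hat {w : V → ℝ} (hw : Measurable w) (f : L2 V) :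
    AEStronglyMeasurable (fun ξ : V => ((w ((2 * π) • ξ) : ℝ) : ℂ) * hat f ξ) volume :=
  (Complex.measurable_ofReal.comp (hw.comp
      (measurable_const_smul _))).aestronglyMeasurable.mul (Lp.aestronglyMeasurable _)

theorem X.memLp_eta (u : X P s) :
    MemLp (fun ξ : V => ((bracket s ((2 * π) • ξ) : ℝ) : ℂ) * hat u.eta ξ) 2 volume :=
  (memSobolev_iff_hat s.2 _).1 u.memX.sobolev_eta

theorem X.memLp_vel (u : X P s) (j : ι) :
    MemLp (fun ξ : V => ((bracket (s + 1 / 2) ((2 * π) • ξ) : ℝ) : ℂ) * hat (u.vel j) ξ)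
      2 volume :=
  (memSobolev_iff_hat (by positivity) _).1 (u.memX.sobolev_vel j)

theorem X.memLp_comp (u : X P s) (o : Option ι) :
    MemLp (fun ξ : V => ((normWeight s o ((2 * π) • ξ) : ℝ) : ℂ) * hat (u.comp o) ξ)
      2 volume := by
  cases o with
  | none => exact u.memLp_eta
  | some j =>
    refine (u.memLp_vel j).of_le_mul (c := 2)
      (aestronglyMeasurable_mul_hat (measurable_normWeight (some j)) _) (.of_forall fun ξ => ?_)
    simp only [norm_mul, Complex.norm_real, Real.norm_eq_abs, abs_of_pos (bracket_pos _ _),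
      abs_of_pos (normWeight_pos _ _), X.comp]
    rw [← mul_assoc]
    refine mul_le_mul_of_nonneg_right ?_ (norm_nonneg _)
    rw [bracket_add, normWeight]
    have := mul_le_mul_of_nonneg_left (inv_symK_le ((2 * π) • ξ))
      (bracket_pos (s : ℝ) ((2 * π) • ξ)).le
    linarith

theorem X.comp_add (u w : X P s) (o : Option ι) : (u + w).comp o = u.comp o + w.comp o := by
  cases o <;> rfl

theorem X.comp_smul (c : ℝ) (u : X P s) (o : Option ι) : (c • u).comp o = c • u.comp o := by
  cases o <;> rfl

/-- The weighted Fourier transforms of the components of `u`. -/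
def X.toHilbert : X P s →ₗ[ℝ] PiLp 2 (fun _ : Option ι => L2 V) where
  toFun u := WithLp.toLp 2 fun o => (u.memLp_comp o).toLp
  map_add' u w := by
    ext o : 1
    simp only [PiLp.add_apply]
    rw [← MemLp.toLp_add, MemLp.toLp_eq_toLp_iff]
    filter_upwards [hat_add (u.comp o) (w.comp o)] with x h
    simp only [X.comp_add, h, Pi.add_apply, mul_add]
  map_smul' c u := by
    ext o : 1
    simp only [PiLp.smul_apply, RingHom.id_apply]
    rw [← MemLp.toLp_const_smul, MemLp.toLp_eq_toLp_iff]
    filter_upwards [hat_smul c (u.comp o)] with x h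
    simp only [X.comp_smul, h, Pi.smul_apply, Complex.real_smul]
    ring

theorem hat_injective {f g : L2 V} (h : hat f =ᵐ[volume] hat g) : f = g :=
  (Lp.fourierTransformₗᵢ V ℂ).injective (Lp.ext h)

theorem X.toHilbert_injective : Function.Injective (X.toHilbert : X P s →ₗ[ℝ] _) := by
  intro u w h
  have hc : ∀ o, u.comp o = w.comp o := by
    intro o
    have h1 := congrArg (fun z : PiLp 2 (fun _ : Option ι => L2 V) => z o) h
    simp only [X.toHilbert, LinearMap.coe_mk, AddHom.coe_mk, MemLp.toLp_eq_toLp_iff] at h1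
    apply hat_injective
    filter_upwards [h1] with x h2
    exact mul_left_cancel₀ (Complex.ofReal_ne_zero.2 (normWeight_pos _ _).ne') h2
  exact Subtype.ext (Prod.ext (hc none) (funext fun j => hc (some j)))

/-- The norm `‖(η, v)‖² = ‖η‖_{H^s}² + ‖K⁻¹ v‖_{H^s}²` of `X^s`; see `X.norm_sq`.
For curl-free `v` it equals `‖𝒦⁻¹ (η, v)‖_{H^s × H^s}`. -/
instance : NormedAddCommGroup (X P s) :=
  NormedAddCommGroup.induced _ _ (X.toHilbert : X P s →ₗ[ℝ] _) X.toHilbert_injective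

instance : NormedSpace ℝ (X P s) :=
  NormedSpace.induced ℝ (X P s) _ (X.toHilbert : X P s →ₗ[ℝ] _)

theorem X.norm_sq (u : X P s) :
    ‖u‖ ^ 2 =
      (eLpNorm (fun ξ : V => ((bracket s ((2 * π) • ξ) : ℝ) : ℂ) * hat u.eta ξ)
        2 volume).toReal ^ 2 +
      ∑ j, (eLpNorm (fun ξ : V => ((bracket s ((2 * π) • ξ) * (symK ((2 * π) • ξ))⁻¹ : ℝ) : ℂ) *
        hat (u.vel j) ξ) 2 volume).toReal ^ 2 := by
  have h : ‖u‖ = ‖(X.toHilbert u : PiLp 2 (fun _ : Option ι => L2 V))‖ := rfl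
  rw [h, PiLp.norm_sq_eq_of_L2, Fintype.sum_option]
  simp only [X.toHilbert, LinearMap.coe_mk, AddHom.coe_mk, Lp.norm_toLp]
  rfl

/-- The element of `X^s` with prescribed Fourier transform `(a, b)`. -/
def X.ofFourier (a : V → ℂ) (b : ι → V → ℂ)
    (hma : AEStronglyMeasurable a volume) (hmb : ∀ j, AEStronglyMeasurable (b j) volume)
    (ha : MemLp (fun ξ : V => ((bracket s ((2 * π) • ξ) : ℝ) : ℂ) * a ξ) 2 volume)
    (hb : ∀ j, MemLp (fun ξ : V => ((bracket (s + 1 / 2) ((2 * π) • ξ) : ℝ) : ℂ) * b j ξ)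
      2 volume)
    (hra : ∀ᵐ ξ : V, a (-ξ) = (starRingEnd ℂ) (a ξ))
    (hrb : ∀ j, ∀ᵐ ξ : V, b j (-ξ) = (starRingEnd ℂ) (b j ξ))
    (hcurl : ∀ j k, ∀ᵐ ξ : V,
      (P.e ((2 * π) • ξ) j : ℂ) * b k ξ = (P.e ((2 * π) • ξ) k : ℂ) * b j ξ) : X P s :=
  have aux : ∀ {r : ℝ} {c : V → ℂ}, 0 ≤ r → AEStronglyMeasurable c volume →
      MemLp (fun ξ : V => ((bracket r ((2 * π) • ξ) : ℝ) : ℂ) * c ξ) 2 volume →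
      MemLp c 2 volume := fun {r c} hr hm h => by
    refine h.mono hm (.of_forall fun ξ => ?_)
    simp only [norm_mul, Complex.norm_real, Real.norm_eq_abs, abs_of_pos (bracket_pos _ _)]
    exact le_mul_of_one_le_left (norm_nonneg _) (one_le_bracket hr _)
  have hLa : MemLp a 2 volume := aux s.2 hma ha
  have hLb : ∀ j, MemLp (b j) 2 volume := fun j => aux (by positivity) (hmb j) (hb j)
  have key : ∀ {c : V → ℂ} (h : MemLp c 2 volume), hat (𝓕⁻ h.toLp : L2 V) =ᵐ[volume] c :=
    fun {c} h => by
      unfold hat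
      rw [FourierTransform.fourier_fourierInv_eq]
      exact h.coeFn_toLp
  have neg : ∀ {f g : V → ℂ}, f =ᵐ[volume] g → ∀ᵐ ξ : V, f (-ξ) = g (-ξ) := fun h =>
    (Measure.measurePreserving_neg (volume : Measure V)).quasiMeasurePreserving.ae h
  ⟨((𝓕⁻ hLa.toLp : L2 V), fun j => (𝓕⁻ (hLb j).toLp : L2 V)), by
    refine ⟨?_, fun j => ?_, ?_, fun j => ?_, fun j k => ?_⟩
    · refine (memSobolev_iff_hat s.2 _).2 ?_
      refine ha.ae_eq ?_
      filter_upwards [key hLa] with x h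
      exact congrArg _ h.symm
    · refine (memSobolev_iff_hat (by positivity) _).2 ?_
      refine (hb j).ae_eq ?_
      filter_upwards [key (hLb j)] with x h
      exact congrArg _ h.symm
    · rw [real_iff_hermitian]
      filter_upwards [key hLa, neg (key hLa), hra] with x h1 h2 h3
      exact h2.trans (h3.trans (congrArg _ h1.symm))
    · rw [real_iff_hermitian]
      filter_upwards [key (hLb j), neg (key (hLb j)), hrb j] with x h1 h2 h3
      exact h2.trans (h3.trans (congrArg _ h1.symm))
    · filter_upwards [key (hLb j), key (hLb k), hcurl j k] with x h1 h2 h3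
      rw [h1, h2, h3]⟩
end

/-- The rows `(1, ± K⁻¹ e) / √2` of the symbol of `𝒦⁻¹`, applied to `(a, b)`. -/
def diagonalize (P : Symbols V ι) (sgn : ℝ) (ω : V) (a : ℂ) (b : ι → ℂ) : ℂ :=
  (a + (sgn * (symK ω)⁻¹ : ℝ) * ∑ j, (P.e ω j : ℂ) * b j) / (√2 : ℝ)

/-- The elevation component of the symbol of `S(t) = 𝒦 diag(e^{-itm}, e^{itm}) 𝒦⁻¹`, where the
first row of the symbol of `𝒦` is `(1, 1) / √2`. -/
def propEta (P : Symbols V ι) (t : ℝ) (ω : V) (a : ℂ) (b : ι → ℂ) : ℂ :=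
  (Complex.exp (-Complex.I * t * P.m ω) * diagonalize P 1 ω a b +
    Complex.exp (Complex.I * t * P.m ω) * diagonalize P (-1) ω a b) / (√2 : ℝ)

/-- The velocity components of the symbol of `S(t)`, where the other rows of the symbol of `𝒦`
are `(K e_j, - K e_j) / √2`. -/
def propVel (P : Symbols V ι) (t : ℝ) (ω : V) (a : ℂ) (b : ι → ℂ) (j : ι) : ℂ :=
  (symK ω * P.e ω j : ℝ) *
    (Complex.exp (-Complex.I * t * P.m ω) * diagonalize P 1 ω a b -
      Complex.exp (Complex.I * t * P.m ω) * diagonalize P (-1) ω a b) / (√2 : ℝ)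

theorem norm_diagonalize_le (P : Symbols V ι) (sgn : ℝ) (hs : |sgn| = 1) (ω : V) (a : ℂ)
    (b : ι → ℂ) :
    ‖diagonalize P sgn ω a b‖ ≤ (‖a‖ + (symK ω)⁻¹ * ∑ j, ‖b j‖) / √2 := by
  have hK := symK_pos ω
  unfold diagonalize
  rw [norm_div, Complex.norm_real, Real.norm_of_nonneg (Real.sqrt_nonneg 2)]
  gcongr
  refine (norm_add_le _ _).trans ?_
  rw [norm_mul, Complex.norm_real, Real.norm_eq_abs, abs_mul, hs, one_mul,
    abs_of_pos (inv_pos.2 hK)]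
  gcongr
  refine (norm_sum_le _ _).trans (Finset.sum_le_sum fun j _ => ?_)
  rw [norm_mul, Complex.norm_real]
  exact mul_le_of_le_one_left (norm_nonneg _) (P.abs_e_le ω j)

theorem norm_exp_phase (x : ℝ) (t : ℝ) :
    ‖Complex.exp (-Complex.I * t * x)‖ = 1 ∧ ‖Complex.exp (Complex.I * t * x)‖ = 1 := by
  constructor <;> simp [Complex.norm_exp]

theorem norm_propEta_le (P : Symbols V ι) (t : ℝ) (ω : V) (a : ℂ) (b : ι → ℂ) :
    ‖propEta P t ω a b‖ ≤ ‖a‖ + (symK ω)⁻¹ * ∑ j, ‖b j‖ := by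
  have h1 := norm_diagonalize_le P 1 (by simp) ω a b
  have h2 := norm_diagonalize_le P (-1) (by simp) ω a b
  have h3 : (0 : ℝ) < √2 := by positivity
  unfold propEta
  rw [norm_div, Complex.norm_real, Real.norm_of_nonneg h3.le, div_le_iff₀ h3]
  refine (norm_add_le _ _).trans ?_
  rw [norm_mul, norm_mul, (norm_exp_phase _ _).1, (norm_exp_phase _ _).2, one_mul, one_mul]
  refine (add_le_add h1 h2).trans (le_of_eq ?_)
  have h4 := Real.mul_self_sqrt (show (0 : ℝ) ≤ 2 by norm_num)
  rw [← add_div, div_eq_iff h3.ne']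
  linear_combination -(‖a‖ + (symK ω)⁻¹ * ∑ j, ‖b j‖) * h4

theorem norm_propVel_le (P : Symbols V ι) (t : ℝ) (ω : V) (a : ℂ) (b : ι → ℂ) (j : ι) :
    ‖propVel P t ω a b j‖ ≤ symK ω * (‖a‖ + (symK ω)⁻¹ * ∑ j, ‖b j‖) := by
  have h1 := norm_diagonalize_le P 1 (by simp) ω a b
  have h2 := norm_diagonalize_le P (-1) (by simp) ω a b
  have h3 : (0 : ℝ) < √2 := by positivity
  have hK := symK_pos ω
  unfold propVel
  rw [norm_div, norm_mul, Complex.norm_real, Complex.norm_real, Real.norm_of_nonneg h3.le,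
    div_le_iff₀ h3, Real.norm_eq_abs, abs_mul, abs_of_pos hK, mul_assoc (symK ω),
    mul_assoc (symK ω)]
  refine mul_le_mul_of_nonneg_left ?_ hK.le
  refine (mul_le_of_le_one_left (norm_nonneg _) (P.abs_e_le ω j)).trans ?_
  refine (norm_sub_le _ _).trans ?_
  rw [norm_mul, norm_mul, (norm_exp_phase _ _).1, (norm_exp_phase _ _).2, one_mul, one_mul]
  refine (add_le_add h1 h2).trans (le_of_eq ?_)
  have h4 := Real.mul_self_sqrt (show (0 : ℝ) ≤ 2 by norm_num)
  rw [← add_div, div_eq_iff h3.ne']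
  linear_combination -(‖a‖ + (symK ω)⁻¹ * ∑ j, ‖b j‖) * h4

theorem prop_conj (P : Symbols V ι) (t : ℝ) (ω : V) (a : ℂ) (b : ι → ℂ) :
    propEta P t (-ω) (starRingEnd ℂ a) (fun j => starRingEnd ℂ (b j)) =
        starRingEnd ℂ (propEta P t ω a b) ∧
      ∀ j, propVel P t (-ω) (starRingEnd ℂ a) (fun j => starRingEnd ℂ (b j)) j =
        starRingEnd ℂ (propVel P t ω a b j) := by
  rcases P.parity ω with ⟨hm, he⟩ | ⟨hm, he⟩
  · constructor
    · simp [propEta, diagonalize, hm, he, symK_neg, ← Complex.exp_conj]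
    · intro j
      simp [propVel, diagonalize, hm, he, symK_neg, ← Complex.exp_conj]
  · constructor
    · simp [propEta, diagonalize, hm, he, symK_neg, ← Complex.exp_conj]
      ring
    · intro j
      simp [propVel, diagonalize, hm, he, symK_neg, ← Complex.exp_conj]
      ring

theorem aestronglyMeasurable_diagonalize (P : Symbols V ι) (sgn : ℝ) {a : V → ℂ} {b : ι → V → ℂ}
    (ha : AEStronglyMeasurable a volume) (hb : ∀ j, AEStronglyMeasurable (b j) volume) :
    AEStronglyMeasurable
      (fun ξ => diagonalize P sgn ((2 * π) • ξ) (a ξ) (fun j => b j ξ)) volume := by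
  have hc := measurable_const_smul (M := ℝ) (α := V) (2 * π)
  simp only [diagonalize, div_eq_mul_inv]
  refine AEStronglyMeasurable.mul (ha.add (AEStronglyMeasurable.mul ?_ ?_))
    aestronglyMeasurable_const
  · exact (Complex.measurable_ofReal.comp
      ((measurable_symK.comp hc).inv.const_mul sgn)).aestronglyMeasurable
  · refine Finset.aestronglyMeasurable_fun_sum _ fun j _ => ?_
    exact (Complex.measurable_ofReal.comp
      ((P.measurable_e j).comp hc)).aestronglyMeasurable.mul (hb j)

theorem aestronglyMeasurable_phase (P : Symbols V ι) (c : ℂ) :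
    AEStronglyMeasurable (fun ξ : V => Complex.exp (c * P.m ((2 * π) • ξ))) volume :=
  (Complex.measurable_exp.comp ((Complex.measurable_ofReal.comp
    (P.measurable_m.comp (measurable_const_smul (2 * π)))).const_mul c)).aestronglyMeasurable

section
variable {P : Symbols V ι} {s : ℝ≥0}

theorem X.aesm_hat (f : L2 V) : AEStronglyMeasurable (hat f) volume := Lp.aestronglyMeasurable _

theorem X.aesm_propEta (t : ℝ) (u : X P s) : AEStronglyMeasurable
    (fun ξ => propEta P t ((2 * π) • ξ) (hat u.eta ξ) (fun j => hat (u.vel j) ξ)) volume := by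
  simp only [propEta, div_eq_mul_inv]
  exact (((aestronglyMeasurable_phase P _).mul (aestronglyMeasurable_diagonalize P 1
    (X.aesm_hat _) fun j => X.aesm_hat _)).add ((aestronglyMeasurable_phase P _).mul
    (aestronglyMeasurable_diagonalize P (-1) (X.aesm_hat _) fun j => X.aesm_hat _))).mul
    aestronglyMeasurable_const

theorem X.aesm_propVel (t : ℝ) (u : X P s) (j : ι) : AEStronglyMeasurable
    (fun ξ => propVel P t ((2 * π) • ξ) (hat u.eta ξ) (fun j => hat (u.vel j) ξ) j) volume := by
  have hc := measurable_const_smul (M := ℝ) (α := V) (2 * π)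
  simp only [propVel, div_eq_mul_inv]
  refine (AEStronglyMeasurable.mul ?_ (((aestronglyMeasurable_phase P _).mul
    (aestronglyMeasurable_diagonalize P 1
    (X.aesm_hat _) fun j => X.aesm_hat _)).sub ((aestronglyMeasurable_phase P _).mul
    (aestronglyMeasurable_diagonalize P (-1) (X.aesm_hat _) fun j => X.aesm_hat _)))).mul
    aestronglyMeasurable_const
  exact (Complex.measurable_ofReal.comp
      ((measurable_symK.comp hc).mul ((P.measurable_e j).comp hc))).aestronglyMeasurable

/-- An `L²` function dominating the weighted components of `S(t) u`. -/
def X.dom (u : X P s) (ξ : V) : ℝ :=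
  2 * (‖((bracket s ((2 * π) • ξ) : ℝ) : ℂ) * hat u.eta ξ‖ +
    ∑ j, ‖((bracket (s + 1 / 2) ((2 * π) • ξ) : ℝ) : ℂ) * hat (u.vel j) ξ‖)

theorem X.memLp_dom (u : X P s) : MemLp u.dom 2 volume :=
  (u.memLp_eta.norm.add (memLp_finsetSum _ fun j _ => (u.memLp_vel j).norm)).const_mul 2

theorem X.memLp_propEta (t : ℝ) (u : X P s) :
    MemLp (fun ξ => ((bracket s ((2 * π) • ξ) : ℝ) : ℂ) *
      propEta P t ((2 * π) • ξ) (hat u.eta ξ) (fun j => hat (u.vel j) ξ)) 2 volume := by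
  refine u.memLp_dom.mono ((Complex.measurable_ofReal.comp ((measurable_bracket _).comp
    (measurable_const_smul _))).aestronglyMeasurable.mul (u.aesm_propEta t))
    (.of_forall fun ξ => ?_)
  refine le_trans ?_ (le_abs_self _)
  unfold X.dom
  simp only [norm_mul, Complex.norm_real, Real.norm_eq_abs, abs_of_pos (bracket_pos _ _)]
  have hB := bracket_pos (s : ℝ) ((2 * π) • ξ)
  have h1 := mul_le_mul_of_nonneg_left
    (norm_propEta_le P t ((2 * π) • ξ) (hat u.eta ξ) (fun j => hat (u.vel j) ξ)) hB.le
  have h2 : 0 ≤ ∑ j, ‖hat (u.vel j) ξ‖ := Finset.sum_nonneg fun _ _ => norm_nonneg _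
  have h3 := mul_le_mul_of_nonneg_left
    (mul_le_mul_of_nonneg_right (inv_symK_le ((2 * π) • ξ)) h2) hB.le
  rw [← Finset.mul_sum, bracket_add]
  have h4 := mul_nonneg hB.le (norm_nonneg (hat u.eta ξ))
  linarith

theorem X.memLp_propVel (t : ℝ) (u : X P s) (j : ι) :
    MemLp (fun ξ => ((bracket (s + 1 / 2) ((2 * π) • ξ) : ℝ) : ℂ) *
      propVel P t ((2 * π) • ξ) (hat u.eta ξ) (fun j => hat (u.vel j) ξ) j) 2 volume := by
  refine u.memLp_dom.mono ((Complex.measurable_ofReal.comp ((measurable_bracket _).comp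
    (measurable_const_smul _))).aestronglyMeasurable.mul (u.aesm_propVel t j))
    (.of_forall fun ξ => ?_)
  refine le_trans ?_ (le_abs_self _)
  unfold X.dom
  simp only [norm_mul, Complex.norm_real, Real.norm_eq_abs, abs_of_pos (bracket_pos _ _)]
  have hB := bracket_pos (s : ℝ) ((2 * π) • ξ)
  have hB2 := bracket_pos (s + 1 / 2 : ℝ) ((2 * π) • ξ)
  have hK := symK_pos ((2 * π) • ξ)
  have h1 := mul_le_mul_of_nonneg_left
    (norm_propVel_le P t ((2 * π) • ξ) (hat u.eta ξ) (fun j => hat (u.vel j) ξ) j) hB2.le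
  have h2 : 0 ≤ ∑ j, ‖hat (u.vel j) ξ‖ := Finset.sum_nonneg fun _ _ => norm_nonneg _
  rw [mul_add, ← mul_assoc (symK _) (symK _)⁻¹, mul_inv_cancel₀ hK.ne', one_mul] at h1
  rw [← Finset.mul_sum]
  have h3 := mul_le_mul_of_nonneg_right (mul_le_mul_of_nonneg_left
    (symK_mul_bracket_le ((2 * π) • ξ)) hB.le) (norm_nonneg (hat u.eta ξ))
  have h4 := mul_nonneg hB2.le h2
  rw [bracket_add] at h1 h4 ⊢
  nlinarith

/-- The unitary group `S(t)` on `X^s`. -/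
def X.propagate (t : ℝ) (u : X P s) : X P s :=
  X.ofFourier
    (fun ξ => propEta P t ((2 * π) • ξ) (hat u.eta ξ) (fun j => hat (u.vel j) ξ))
    (fun j ξ => propVel P t ((2 * π) • ξ) (hat u.eta ξ) (fun j => hat (u.vel j) ξ) j)
    (u.aesm_propEta t) (u.aesm_propVel t) (u.memLp_propEta t) (u.memLp_propVel t)
    (by
      filter_upwards [(real_iff_hermitian _).1 u.memX.real_eta,
        ae_all_iff.2 fun j => (real_iff_hermitian _).1 (u.memX.real_vel j)] with ξ h1 h2
      rw [← (prop_conj P t _ _ _).1, smul_neg]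
      exact congrArg₂ _ h1 (funext h2))
    (fun j => by
      filter_upwards [(real_iff_hermitian _).1 u.memX.real_eta,
        ae_all_iff.2 fun j => (real_iff_hermitian _).1 (u.memX.real_vel j)] with ξ h1 h2
      rw [← (prop_conj P t _ _ _).2 j, smul_neg]
      exact congrFun (congrArg₂ (propVel P t _) h1 (funext h2)) j)
    (fun j k => .of_forall fun ξ => by
      simp only [propVel, Complex.ofReal_mul]
      ring)

/-- `F` is the forcing term produced by `u = (η, v)`, i.e. it has the Fourier transform
`(-i Σ_j g_j (η v_j)^, (-i g_j (|v|² / 2)^)_j)`. As `η, v_j ∈ L²`, the products are integrable and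
their Fourier transforms are given by the classical convergent integral. -/
def IsForcing (u F : X P s) : Prop :=
  (∀ᵐ ξ : V, hat F.eta ξ =
    -Complex.I * ∑ j, (P.g ((2 * π) • ξ) j : ℂ) * 𝓕 (fun x => u.eta x * u.vel j x) ξ) ∧
  ∀ j, ∀ᵐ ξ : V, hat (F.vel j) ξ =
    -Complex.I * (P.g ((2 * π) • ξ) j : ℂ) * 𝓕 (fun x => (∑ k, u.vel k x ^ 2) / 2) ξ

/-- `w = 𝒜(u; u₀)`: with `F(t)` the forcing term of `u(t)`, a continuous curve in `X^s`,
`w(t) = S(t) u₀ + ∫₀ᵗ S(t - t') F(t') dt'` for all `t ∈ [0, T]`. -/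
def IsDuhamelImage (T : ℝ) (u₀ : X P s) (u w : C(Set.Icc (0 : ℝ) T, X P s)) : Prop :=
  ∃ F : ℝ → X P s, ContinuousOn F (Set.Icc 0 T) ∧
    ∀ t : Set.Icc (0 : ℝ) T, IsForcing (u t) (F t) ∧
      w t = X.propagate t u₀ + ∫ t' in (0 : ℝ)..t, X.propagate (t - t') (F t')
end
end

theorem abs_div_le_one_of_le {x y : ℝ} (hy : 0 ≤ y) (h : |x| ≤ y) : |x / y| ≤ 1 := by
  rw [abs_div, abs_of_nonneg hy]
  exact div_le_one_of_le₀ h hy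

theorem measurable_tanh : Measurable Real.tanh := by
  have : Real.tanh = fun x => Real.sinh x / Real.cosh x := by
    ext x; exact Real.tanh_eq_sinh_div_cosh x
  rw [this]; fun_prop

/-- The system on the line: `m = √(ω tanh ω) sgn ω`, `𝒦 = ((1, 1), (K, -K)) / √2`, and the
operator `-i tanh D` acting on `(η v, v² / 2)`. -/
def line : Symbols ℝ Unit where
  m ω := √(ω * Real.tanh ω) * SignType.sign ω
  e _ _ := 1
  g ω _ := Real.tanh ω
  measurable_m := by
    have h : Measurable fun ω : ℝ => ((SignType.sign ω : SignType) : ℝ) := by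
      have : (fun ω : ℝ => ((SignType.sign ω : SignType) : ℝ)) =
          fun ω => if 0 < ω then 1 else if ω < 0 then -1 else 0 := by
        ext ω
        rw [sign_apply]
        split_ifs <;> simp
      rw [this]
      exact Measurable.ite measurableSet_Ioi measurable_const
        (Measurable.ite measurableSet_Iio measurable_const measurable_const)
    exact ((measurable_id.mul measurable_tanh).sqrt).mul h
  measurable_e _ := measurable_const
  abs_e_le _ _ := by simp
  parity ω := Or.inl ⟨by simp [Real.tanh_neg, Left.sign_neg], fun _ => rfl⟩

/-- The system on the plane: `m = |ω| K`, `𝒦 = ((1, 1), (-iKR_j, iKR_j)) / √2` with the Riesz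
transforms `R_j` of symbol `i ω_j / |ω|`, and the operators `-K² ∂_j` of symbol `-i K² ω_j`, which
act as `-K² ∇ · (η v)` and `-K² ∇ (|v|² / 2)`. -/
def plane : Symbols (EuclideanSpace ℝ (Fin 2)) (Fin 2) where
  m ω := ‖ω‖ * symK ω
  e ω j := ω j / ‖ω‖
  g ω j := symK ω ^ 2 * ω j
  measurable_m := measurable_norm.mul measurable_symK
  measurable_e j := by fun_prop
  abs_e_le ω j := abs_div_le_one_of_le (norm_nonneg _) (by
    simpa using PiLp.norm_apply_le ω j)
  parity ω := Or.inr ⟨by simp only [norm_neg, symK_neg], fun j => by simp [neg_div]⟩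

end
end WhithamBoussinesq

open WhithamBoussinesq

namespace WhithamBoussinesq
noncomputable section

/-! ### Duhamel's formula for a bounded, strongly continuous family of operators -/

section Duhamel
open Set Filter Topology
variable {E : Type*} [NormedAddCommGroup E] [NormedSpace ℝ E] {S : ℝ → E →L[ℝ] E} {M : ℝ}

/-! The system is semilinear. In both dimensions the operators in front of the nonlinearity have
bounded symbols (`tanh ω`, respectively `K² ω_j`), so the quadratic term loses no derivative, and
the integral equation has the form `u = L u₀ + Q(u, u)` with `L` bounded linear and `Q` bounded
bilinear on `C([0, T]; X^s)`.

Three facts about `X^s` give this form. It is complete: the weighted Fourier transform embeds it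
isometrically into a finite sum of copies of `L²`, with image cut out by the closed conditions
"Hermitian" and "curl free". The family `S(t)` is uniformly bounded and strongly continuous: once
the weights are absorbed it becomes multiplication by a matrix with entries bounded by `1` and
continuous in `t`. The forcing is a bounded bilinear map `B` (`exists_forcing`). This last fact
rests on the product estimate `‖fg‖_{H^r} ≤ C ‖f‖_{H^r} ‖g‖_{H^σ}` for `0 ≤ r ≤ σ`, `σ > d/2`. Every
product in the system has a velocity factor in `H^{s+1/2}`, so `σ = s + 1/2` serves, with `r = s`
for `η v_j` and `r = s + 1/2` for `|v|²`. The requirement `s + 1/2 > d/2` is `s > 0` for `d = 1` and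
`s > 1/2` for `d = 2`.

With `‖S(t)‖ ≤ M` one has `‖L‖ ≤ M` and `‖Q(u, w)‖ ≤ M ‖B‖ T ‖u‖ ‖w‖`, so existence follows by
contraction as soon as `8 M² ‖B‖ T ‖u₀‖ ≤ 1`. Uniqueness holds in all of `C([0, T]; X^s)`, without
smallness, by a Gronwall argument (`duhamel_unique`). Analyticity of the flow comes from the
analytic inverse function theorem for `z ↦ z - Q(z, z)`: uniqueness identifies the local inverse
composed with `L` with the solution map (`analyticOnNhd_quadratic_fixedPoint`).

Only boundedness and strong continuity of `S(t)` are used, not unitarity or the group law. -/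

theorem continuous_uncurry_of_bounded (hM : ∀ t, ‖S t‖ ≤ M) (hS : ∀ u, Continuous fun t => S t u) :
    Continuous fun p : ℝ × E => S p.1 p.2 := by
  -- The uniform operator bound makes the maps `S t` equi-Lipschitz, which upgrades strong
  -- continuity to joint continuity.
  have h := continuous_prod_of_continuous_lipschitzWith' (f := fun p : ℝ × E => S p.1 p.2)
    M.toNNReal (fun t => ?_) hS
  · exact h
  · exact (S t).lipschitz.weaken (by
      rw [← NNReal.coe_le_coe, coe_nnnorm]
      exact (hM t).trans (Real.le_coe_toNNReal M))

/-- The curve `t ↦ S(t) u` on `[0, T]`, as a function of `u`. -/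
def freeFlow (T : ℝ) (hM : ∀ t, ‖S t‖ ≤ M) (hS : ∀ u, Continuous fun t => S t u) :
    E →L[ℝ] C(Icc (0 : ℝ) T, E) :=
  LinearMap.mkContinuous
    { toFun := fun u => ⟨fun t => S t u, (hS u).comp continuous_subtype_val⟩
      map_add' := fun u w => by ext t; simp
      map_smul' := fun c u => by ext t; simp } M fun u => by
    have hM0 : 0 ≤ M := (norm_nonneg _).trans (hM 0)
    refine (ContinuousMap.norm_le _ (by positivity)).2 fun t => ?_
    exact (S t).le_of_opNorm_le (hM t) u

@[simp]
theorem freeFlow_apply (T : ℝ) (hM : ∀ t, ‖S t‖ ≤ M) (hS : ∀ u, Continuous fun t => S t u)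
    (u : E) (t : Icc (0 : ℝ) T) : freeFlow T hM hS u t = S t u := rfl

theorem norm_freeFlow_le (T : ℝ) (hM : ∀ t, ‖S t‖ ≤ M) (hS : ∀ u, Continuous fun t => S t u)
    (u : E) : ‖freeFlow T hM hS u‖ ≤ M * ‖u‖ :=
  ContinuousLinearMap.le_of_opNorm_le _
    (LinearMap.mkContinuous_norm_le _ ((norm_nonneg _).trans (hM 0)) _) u

theorem continuous_duhamel_integrand (hM : ∀ t, ‖S t‖ ≤ M) (hS : ∀ u, Continuous fun t => S t u)
    {G : ℝ → E} (hG : Continuous G) :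
    Continuous (Function.uncurry fun t t' : ℝ => S (t - t') (G t')) :=
  (continuous_uncurry_of_bounded hM hS).comp
    ((continuous_fst.sub continuous_snd).prodMk (hG.comp continuous_snd))

theorem continuous_bilinear_extend {T : ℝ} (hT : 0 ≤ T) (B : E →L[ℝ] E →L[ℝ] E)
    (u w : C(Icc (0 : ℝ) T, E)) :
    Continuous fun t => B (u (projIcc 0 T hT t)) (w (projIcc 0 T hT t)) :=
  B.continuous₂.comp ((u.continuous.comp continuous_projIcc).prodMk
    (w.continuous.comp continuous_projIcc))

/-- The factor `T`, the length of the time interval, is the only source of smallness for the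
quadratic term. Composing with `projIcc` extends curves on `[0, T]` to the line by constants, so
that integrands are continuous everywhere. -/
theorem norm_duhamel_integral_le {T : ℝ} (hT : 0 ≤ T) (hM : ∀ t, ‖S t‖ ≤ M)
    (B : E →L[ℝ] E →L[ℝ] E) (u w : C(Icc (0 : ℝ) T, E)) (t : Icc (0 : ℝ) T) :
    ‖∫ t' in (0 : ℝ)..t, S (t - t') (B (u (projIcc 0 T hT t')) (w (projIcc 0 T hT t')))‖ ≤
      M * ‖B‖ * T * ‖u‖ * ‖w‖ := by
  have hM0 : 0 ≤ M := (norm_nonneg _).trans (hM 0)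
  refine (intervalIntegral.norm_integral_le_of_norm_le_const
    (C := M * (‖B‖ * ‖u‖ * ‖w‖)) fun x _ => ?_).trans ?_
  · refine ((S _).le_of_opNorm_le (hM _) _).trans ?_
    gcongr
    refine (B.le_opNorm₂ _ _).trans ?_
    gcongr <;> exact ContinuousMap.norm_coe_le_norm _ _
  · rw [sub_zero, abs_of_nonneg t.2.1]
    have := mul_le_mul_of_nonneg_left t.2.2
      (show 0 ≤ M * (‖B‖ * ‖u‖ * ‖w‖) by positivity)
    linarith

/-- The bilinear Duhamel term `∫₀ᵗ S(t - t') B(u(t'), w(t')) dt'`. -/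
def duhamel {T : ℝ} (hT : 0 ≤ T) (hM : ∀ t, ‖S t‖ ≤ M) (hS : ∀ u, Continuous fun t => S t u)
    (B : E →L[ℝ] E →L[ℝ] E) :
    C(Icc (0 : ℝ) T, E) →L[ℝ] C(Icc (0 : ℝ) T, E) →L[ℝ] C(Icc (0 : ℝ) T, E) :=
  LinearMap.mkContinuous₂ (LinearMap.mk₂ ℝ (fun u w =>
      ⟨fun t => ∫ t' in (0 : ℝ)..t, S (t - t') (B (u (projIcc 0 T hT t')) (w (projIcc 0 T hT t'))),
        (intervalIntegral.continuous_parametric_intervalIntegral_of_continuous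
          (continuous_duhamel_integrand hM hS (continuous_bilinear_extend hT B u w))
          continuous_id).comp continuous_subtype_val⟩)
      (fun u u' w => by
        ext t
        simp only [ContinuousMap.add_apply, ContinuousMap.coe_mk, map_add,
          add_apply]
        refine intervalIntegral.integral_add ?_ ?_ <;>
        exact ((continuous_duhamel_integrand hM hS
          (continuous_bilinear_extend hT B _ w)).comp (Continuous.prodMk_right _)).intervalIntegrable _ _)
      (fun c u w => by
        ext t
        simp only [ContinuousMap.smul_apply, ContinuousMap.coe_mk, map_smul,
          smul_apply, intervalIntegral.integral_smul])
      (fun u w w' => by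
        ext t
        simp only [ContinuousMap.add_apply, ContinuousMap.coe_mk, map_add]
        refine intervalIntegral.integral_add ?_ ?_ <;>
        exact ((continuous_duhamel_integrand hM hS
          (continuous_bilinear_extend hT B u _)).comp (Continuous.prodMk_right _)).intervalIntegrable _ _)
      (fun c u w => by
        ext t
        simp only [ContinuousMap.smul_apply, ContinuousMap.coe_mk, map_smul,
          intervalIntegral.integral_smul])) (M * ‖B‖ * T) fun u w => by
    have hM0 : 0 ≤ M := (norm_nonneg _).trans (hM 0)
    exact (ContinuousMap.norm_le _ (by positivity)).2 fun t =>
      norm_duhamel_integral_le hT hM B u w t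

theorem duhamel_apply {T : ℝ} (hT : 0 ≤ T) (hM : ∀ t, ‖S t‖ ≤ M)
    (hS : ∀ u, Continuous fun t => S t u) (B : E →L[ℝ] E →L[ℝ] E) (u w : C(Icc (0 : ℝ) T, E))
    (t : Icc (0 : ℝ) T) : duhamel hT hM hS B u w t =
      ∫ t' in (0 : ℝ)..t, S (t - t') (B (u (projIcc 0 T hT t')) (w (projIcc 0 T hT t'))) := rfl

theorem norm_duhamel_apply_le {T : ℝ} (hT : 0 ≤ T) (hM : ∀ t, ‖S t‖ ≤ M)
    (hS : ∀ u, Continuous fun t => S t u) (B : E →L[ℝ] E →L[ℝ] E) (u w : C(Icc (0 : ℝ) T, E)) :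
    ‖duhamel hT hM hS B u w‖ ≤ M * ‖B‖ * T * ‖u‖ * ‖w‖ := by
  have hM0 : 0 ≤ M := (norm_nonneg _).trans (hM 0)
  exact (ContinuousMap.norm_le _ (by positivity)).2 fun t =>
    norm_duhamel_integral_le hT hM B u w t

/-- Gronwall: `B` is Lipschitz on bounded sets, so the distance `d(t)` of two solutions satisfies
`d(t) ≤ A ∫₀ᵗ d`, where `A` depends on the norms of both. No smallness of `T` or of the solutions
enters. -/
theorem duhamel_unique {T : ℝ} (hT : 0 ≤ T) (hM : ∀ t, ‖S t‖ ≤ M)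
    (hS : ∀ u, Continuous fun t => S t u) (B : E →L[ℝ] E →L[ℝ] E) {a u w : C(Icc (0 : ℝ) T, E)}
    (hu : u = a + duhamel hT hM hS B u u) (hw : w = a + duhamel hT hM hS B w w) : u = w := by
  have hM0 : 0 ≤ M := (norm_nonneg _).trans (hM 0)
  set d : ℝ → ℝ := fun t => ‖u (projIcc 0 T hT t) - w (projIcc 0 T hT t)‖ with hd
  have hdc : Continuous d := ((u.continuous.comp continuous_projIcc).sub
    (w.continuous.comp continuous_projIcc)).norm
  set A : ℝ := M * (‖B‖ * (‖u‖ + ‖w‖)) with hA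
  have hA0 : 0 ≤ A := by positivity
  have hle : ∀ t ∈ Icc (0 : ℝ) T, d t ≤ A * ∫ x in (0 : ℝ)..t, d x := by
    intro t ht
    have e1 : u ⟨t, ht⟩ - w ⟨t, ht⟩ = ∫ x in (0 : ℝ)..t,
        S (t - x) (B (u (projIcc 0 T hT x)) (u (projIcc 0 T hT x)) -
          B (w (projIcc 0 T hT x)) (w (projIcc 0 T hT x))) := by
      conv_lhs => rw [hu, hw]
      simp only [ContinuousMap.add_apply, add_sub_add_left_eq_sub, duhamel_apply, map_sub]
      rw [intervalIntegral.integral_sub] <;>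
      exact ((continuous_duhamel_integrand hM hS
          (continuous_bilinear_extend hT B _ _)).comp (Continuous.prodMk_right _)).intervalIntegrable _ _
    have e2 : d t = ‖u ⟨t, ht⟩ - w ⟨t, ht⟩‖ := by simp only [hd, projIcc_of_mem hT ht]
    rw [e2, e1, ← intervalIntegral.integral_const_mul]
    refine intervalIntegral.norm_integral_le_of_norm_le ht.1 (.of_forall fun x _ => ?_)
      ((hdc.const_mul A).intervalIntegrable _ _)
    refine ((S _).le_of_opNorm_le (hM _) _).trans ?_
    rw [hA, mul_assoc]
    gcongr
    set y := u (projIcc 0 T hT x)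
    set z := w (projIcc 0 T hT x)
    have e3 : B y y - B z z = B y (y - z) + B (y - z) z := by simp
    have hy : ‖y‖ ≤ ‖u‖ := ContinuousMap.norm_coe_le_norm _ _
    have hz : ‖z‖ ≤ ‖w‖ := ContinuousMap.norm_coe_le_norm _ _
    calc ‖B y y - B z z‖ ≤ ‖B‖ * ‖y‖ * ‖y - z‖ + ‖B‖ * ‖y - z‖ * ‖z‖ := by
          rw [e3]
          exact (norm_add_le _ _).trans (add_le_add (B.le_opNorm₂ _ _) (B.le_opNorm₂ _ _))
      _ ≤ ‖B‖ * ‖u‖ * ‖y - z‖ + ‖B‖ * ‖y - z‖ * ‖w‖ := by gcongr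
      _ = ‖B‖ * (‖u‖ + ‖w‖) * d x := by simp only [hd]; ring
  have hI0 : ∀ t ∈ Icc (0 : ℝ) T, 0 ≤ ∫ x in (0 : ℝ)..t, d x := fun t ht =>
    intervalIntegral.integral_nonneg ht.1 fun x _ => norm_nonneg _
  -- Gronwall is applied to the primitive `I(t) = ∫₀ᵗ d`, which is differentiable with `I' = d ≤ A
  -- I` and `I(0) = 0`, whereas `d` itself is only continuous.
  have hzero := eq_zero_of_abs_deriv_le_mul_abs_self_of_eq_zero_right
    (f := fun t => ∫ x in (0 : ℝ)..t, d x) (f' := d) (K := A) (a := 0) (b := T)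
    (intervalIntegral.continuous_primitive
      (fun _ _ => hdc.intervalIntegrable _ _) 0).continuousOn
    (fun x _ => (intervalIntegral.integral_hasDerivAt_right (hdc.intervalIntegrable _ _)
      (hdc.stronglyMeasurableAtFilter _ _) hdc.continuousAt).hasDerivWithinAt)
    intervalIntegral.integral_same
    (fun x hx => by
      rw [Real.norm_of_nonneg (norm_nonneg _), Real.norm_of_nonneg (hI0 x (Ico_subset_Icc_self hx))]
      exact hle x (Ico_subset_Icc_self hx))
  ext t
  have h := hle t t.2
  have hz : ∫ x in (0 : ℝ)..t, d x = 0 := hzero t t.2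
  rw [hz, mul_zero] at h
  simp only [hd, projIcc_val] at h
  exact sub_eq_zero.1 (norm_le_zero_iff.1 h)

end Duhamel

/-! ### Quadratic fixed-point equations in a Banach space -/

section Quadratic
open Set Filter Topology
variable {Z : Type*} [NormedAddCommGroup Z] [NormedSpace ℝ Z] [CompleteSpace Z]

/-- Contraction principle for `z = a + Q(z, z)`. -/
theorem exists_quadratic_fixedPoint (Q : Z →L[ℝ] Z →L[ℝ] Z) (a : Z) {q r : ℝ} (hq0 : 0 ≤ q)
    (hQ : ∀ x y, ‖Q x y‖ ≤ q * ‖x‖ * ‖y‖) (ha : ‖a‖ ≤ r) (hqr : 8 * q * r ≤ 1) :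
    ∃ z, ‖z‖ ≤ 2 * r ∧ z = a + Q z z := by
  have hr : 0 ≤ r := (norm_nonneg a).trans ha
  have hmaps : MapsTo (fun z => a + Q z z) (Metric.closedBall (0 : Z) (2 * r))
      (Metric.closedBall 0 (2 * r)) := by
    intro z hz
    rw [mem_closedBall_zero_iff] at hz ⊢
    have h1 : q * ‖z‖ * ‖z‖ ≤ q * (2 * r) * (2 * r) := by gcongr
    have h2 := mul_le_mul_of_nonneg_right hqr hr
    refine (norm_add_le _ _).trans ((add_le_add ha (hQ z z)).trans ?_)
    nlinarith
  have hcon : ContractingWith (1 / 2) (hmaps.restrict _ _ _) := by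
    refine ⟨by norm_num [← NNReal.coe_lt_coe], LipschitzWith.of_dist_le_mul fun x y => ?_⟩
    obtain ⟨x, hx⟩ := x
    obtain ⟨y, hy⟩ := y
    rw [mem_closedBall_zero_iff] at hx hy
    rw [Subtype.dist_eq, Subtype.dist_eq, dist_eq_norm, dist_eq_norm]
    simp only [MapsTo.val_restrict_apply, add_sub_add_left_eq_sub]
    have e : Q x x - Q y y = Q x (x - y) + Q (x - y) y := by simp
    calc ‖Q x x - Q y y‖ ≤ q * ‖x‖ * ‖x - y‖ + q * ‖x - y‖ * ‖y‖ := by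
          rw [e]; exact (norm_add_le _ _).trans (add_le_add (hQ _ _) (hQ _ _))
      _ ≤ q * (2 * r) * ‖x - y‖ + q * ‖x - y‖ * (2 * r) := by gcongr
      -- The Lipschitz constant on the ball is `4 q r`, and `8 q r ≤ 1` makes it at most `1/2`.
      _ = 8 * q * r / 2 * ‖x - y‖ := by ring
      _ ≤ _ := by
        push_cast
        gcongr
  obtain ⟨z, hz, hfix, -⟩ := hcon.exists_fixedPoint' Metric.isClosed_closedBall.isComplete hmaps
    (x := 0) (Metric.mem_closedBall_self (by positivity)) (edist_ne_top _ _)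
  exact ⟨z, mem_closedBall_zero_iff.1 hz, hfix.symm⟩

/-- Analytic dependence on the parameter of the solution of `z = L x + Q(z, z)`, by inversion of
the analytic map `z ↦ z - Q(z, z)`. -/
theorem analyticOnNhd_quadratic_fixedPoint {E : Type*} [NormedAddCommGroup E] [NormedSpace ℝ E]
    (Q : Z →L[ℝ] Z →L[ℝ] Z) (L : E →L[ℝ] Z) {U : Set E} (hU : IsOpen U) {Φ : E → Z} {q : ℝ}
    (hq0 : 0 ≤ q) (hQ : ∀ x y, ‖Q x y‖ ≤ q * ‖x‖ * ‖y‖)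
    (hsol : ∀ x ∈ U, ∀ z, z = L x + Q z z ↔ z = Φ x)
    (hsmall : ∀ x ∈ U, 2 * q * ‖Φ x‖ < 1) : AnalyticOnNhd ℝ Φ U := by
  intro x hx
  set G : Z → Z := fun z => z - Q z z with hG
  set z := Φ x with hz
  have hGz : G z = L x := by
    exact sub_eq_iff_eq_add.2 ((hsol x hx z).2 rfl)
  have hA : AnalyticAt ℝ G z := analyticAt_id.sub
    ((Q.analyticAt_bilinear (z, z)).comp_of_eq
      (analyticAt_id.prod analyticAt_id) rfl)
  set N : Z →L[ℝ] Z := Q z + Q.flip z with hN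
  have hd : HasFDerivAt G (ContinuousLinearMap.id ℝ Z - N) z := by
    have h := (hasFDerivAt_id z).sub (Q.hasFDerivAt_of_bilinear (hasFDerivAt_id z) (hasFDerivAt_id z))
    refine h.congr_fderiv ?_
    ext y
    simp [hN]
  -- The derivative of `z ↦ Q(z, z)` has norm at most `2 q ‖z‖ < 1`, so the derivative of `G` is
  -- invertible by the Neumann series.
  have hN1 : ‖N‖ < 1 := by
    refine lt_of_le_of_lt (norm_add_le _ _) ?_
    have h1 := (Q z).opNorm_le_bound (by positivity) fun y => hQ z y
    have h2 := (Q.flip z).opNorm_le_bound (M := q * ‖z‖) (by positivity) fun y => by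
      rw [ContinuousLinearMap.flip_apply, mul_right_comm]; exact hQ y z
    linarith [hsmall x hx]
  set i : Z ≃L[ℝ] Z := ContinuousLinearEquiv.unitsEquiv ℝ Z (Units.oneSub N hN1) with hi
  have hcoe : (i : Z →L[ℝ] Z) = ContinuousLinearMap.id ℝ Z - N := by
    ext y; rfl
  have hst : HasStrictFDerivAt G (i : Z →L[ℝ] Z) z := by
    have h := hA.hasStrictFDerivAt
    rwa [hd.fderiv, ← hcoe] at h
  have hinv : AnalyticAt ℝ (hst.localInverse G i z) (G z) :=
    OpenPartialHomeomorph.analyticAt_symm' (hst.toOpenPartialHomeomorph G) (i := i)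
      hst.mem_toOpenPartialHomeomorph_source hA (by rw [hcoe]; exact hd.fderiv)
  rw [hGz] at hinv
  -- Near `x` the local inverse of `G` at `L y` solves `z = L y + Q(z, z)`, hence equals `Φ y` by
  -- `hsol`. No prior continuity of `Φ` is needed.
  refine (hinv.comp (L.analyticAt x)).congr ?_
  have hev : ∀ᶠ y in 𝓝 (L x), G (hst.localInverse G i z y) = y := by
    have := hst.eventually_right_inverse
    rwa [hGz] at this
  filter_upwards [L.continuous.continuousAt.eventually hev, hU.mem_nhds hx] with y hy hyU
  refine (hsol y hyU _).1 ?_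
  rw [← sub_eq_iff_eq_add]
  exact hy

end Quadratic

/-! ### The space `X^s` in weighted Fourier coordinates, and its completeness -/

section
set_option linter.unusedSectionVars false
open Filter Topology
open scoped ENNReal
variable {V : Type} [NormedAddCommGroup V] [InnerProductSpace ℝ V] [FiniteDimensional ℝ V]
  [MeasurableSpace V] [BorelSpace V] {ι : Type} [Fintype ι] {P : Symbols V ι} {s : ℝ≥0}

/-- The weighted Fourier transform of a component of `u`. -/
def X.weighted (u : X P s) (o : Option ι) : L2 V := (u.memLp_comp o).toLp

theorem X.coeFn_weighted (u : X P s) (o : Option ι) :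
    u.weighted o =ᵐ[volume]
      fun ξ : V => ((normWeight s o ((2 * π) • ξ) : ℝ) : ℂ) * hat (u.comp o) ξ :=
  (u.memLp_comp o).coeFn_toLp

theorem X.toHilbert_apply (u : X P s) (o : Option ι) : X.toHilbert u o = u.weighted o := rfl

theorem X.weighted_injective {u w : X P s} (h : ∀ o, u.weighted o = w.weighted o) : u = w :=
  X.toHilbert_injective (PiLp.ext h)

theorem X.weighted_add (u w : X P s) (o : Option ι) :
    (u + w).weighted o = u.weighted o + w.weighted o := by
  simp only [← X.toHilbert_apply, map_add, PiLp.add_apply]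

theorem X.weighted_smul (c : ℝ) (u : X P s) (o : Option ι) :
    (c • u).weighted o = c • u.weighted o := by
  simp only [← X.toHilbert_apply, map_smul, PiLp.smul_apply]

theorem X.norm_weighted_le (u : X P s) (o : Option ι) : ‖u.weighted o‖ ≤ ‖u‖ :=
  PiLp.norm_apply_le (X.toHilbert u) o

theorem X.norm_le_sum (u : X P s) : ‖u‖ ≤ ∑ o, ‖u.weighted o‖ := by
  have h : ‖u‖ = ‖X.toHilbert u‖ := rfl
  rw [h, PiLp.norm_eq_of_L2]
  exact Real.sqrt_le_iff.2 ⟨Finset.sum_nonneg fun _ _ => norm_nonneg _,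
    Finset.sum_sq_le_sq_sum_of_nonneg fun _ _ => norm_nonneg _⟩

theorem hat_fourierInv_toLp {c : V → ℂ} (h : MemLp c 2 volume) :
    hat (𝓕⁻ h.toLp : L2 V) =ᵐ[volume] c := by
  unfold hat
  rw [FourierTransform.fourier_fourierInv_eq]
  exact h.coeFn_toLp

theorem ae_neg {p : V → Prop} (h : ∀ᵐ ξ : V, p ξ) : ∀ᵐ ξ : V, p (-ξ) :=
  (Measure.measurePreserving_neg (volume : Measure V)).quasiMeasurePreserving.ae h

theorem normWeight_neg (o : Option ι) (ω : V) : normWeight s o (-ω) = normWeight s o ω := by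
  cases o <;> simp only [normWeight, bracket_neg, symK_neg]

/-- The weight `⟨ω⟩^s` or `⟨ω⟩^{s+1/2}` of the Sobolev space of a component. -/
def sobolevExponent (s : ℝ≥0) : Option ι → ℝ
  | none => s
  | some _ => s + 1 / 2

theorem sobolevExponent_nonneg (o : Option ι) : 0 ≤ sobolevExponent s o := by
  cases o <;> simp only [sobolevExponent] <;> positivity

/-- `K` is comparable to `⟨ω⟩^{-1/2}`, so the weight `⟨ω⟩^s K⁻¹` of the velocity is equivalent to
the weight `⟨ω⟩^{s+1/2}`. This and the reverse bound pass between the norm of `X^s` and the Sobolev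
norms in which products are estimated. -/
theorem normWeight_le (o : Option ι) (ω : V) :
    normWeight s o ω ≤ 2 * bracket (sobolevExponent s o) ω := by
  have hb := bracket_pos (s : ℝ) ω
  cases o with
  | none => simp only [normWeight, sobolevExponent]; linarith
  | some j =>
    simp only [normWeight, sobolevExponent, bracket_add]
    have := mul_le_mul_of_nonneg_left (inv_symK_le ω) hb.le
    linarith

theorem bracket_le_normWeight (o : Option ι) (ω : V) :
    bracket (sobolevExponent s o) ω ≤ 2 * normWeight s o ω := by
  have hb := bracket_pos (s : ℝ) ω
  cases o with
  | none => simp only [normWeight, sobolevExponent]; linarith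
  | some j =>
    simp only [normWeight, sobolevExponent, bracket_add]
    have hK := symK_pos ω
    have h := symK_mul_bracket_le ω
    rw [← le_div_iff₀' hK] at h
    calc _ ≤ bracket s ω * (2 / symK ω) := by gcongr
      _ = _ := by ring

theorem memLp_of_bracket_mul {r : ℝ} (hr : 0 ≤ r) {c : V → ℂ}
    (hm : AEStronglyMeasurable c volume)
    (h : MemLp (fun ξ : V => ((bracket r ((2 * π) • ξ) : ℝ) : ℂ) * c ξ) 2 volume) :
    MemLp c 2 volume := by
  refine h.mono hm (.of_forall fun ξ => ?_)
  simp only [norm_mul, Complex.norm_real, Real.norm_eq_abs, abs_of_pos (bracket_pos _ _)]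
  exact le_mul_of_one_le_left (norm_nonneg _) (one_le_bracket hr _)

theorem X.exists_hat_eq (a : Option ι → V → ℂ) (hm : ∀ o, AEStronglyMeasurable (a o) volume)
    (hL : ∀ o, MemLp (fun ξ : V => ((bracket (sobolevExponent s o) ((2 * π) • ξ) : ℝ) : ℂ) * a o ξ)
      2 volume)
    (hr : ∀ o, ∀ᵐ ξ : V, a o (-ξ) = (starRingEnd ℂ) (a o ξ))
    (hcurl : ∀ j k, ∀ᵐ ξ : V, (P.e ((2 * π) • ξ) j : ℂ) * a (some k) ξ =
      (P.e ((2 * π) • ξ) k : ℂ) * a (some j) ξ) :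
    ∃ u : X P s, ∀ o, hat (u.comp o) =ᵐ[volume] a o :=
  ⟨X.ofFourier (a none) (fun j => a (some j)) (hm none) (fun j => hm (some j)) (hL none)
    (fun j => hL (some j)) (hr none) (fun j => hr (some j)) hcurl, fun o => by
    have ha := memLp_of_bracket_mul (sobolevExponent_nonneg o) (hm o) (hL o)
    cases o with
    | none =>
      change hat (𝓕⁻ ha.toLp) =ᵐ[volume] _
      exact hat_fourierInv_toLp ha
    | some j =>
      change hat (𝓕⁻ ha.toLp) =ᵐ[volume] _
      exact hat_fourierInv_toLp ha⟩

/-- Dividing by the weights preserves both constraints: the weights are real and even, which keeps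
Hermitian symmetry, and all velocity components carry the same weight, which keeps the curl
relation. Thus the weighted coordinates fill the whole constrained space. -/
theorem X.exists_weighted_eq (h : Option ι → L2 V)
    (hr : ∀ o, ∀ᵐ ξ : V, h o (-ξ) = (starRingEnd ℂ) (h o ξ))
    (hcurl : ∀ j k, ∀ᵐ ξ : V, (P.e ((2 * π) • ξ) j : ℂ) * h (some k) ξ =
      (P.e ((2 * π) • ξ) k : ℂ) * h (some j) ξ) :
    ∃ u : X P s, ∀ o, u.weighted o = h o := by
  have hc := measurable_const_smul (M := ℝ) (α := V) (2 * π)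
  have hm : ∀ o, AEStronglyMeasurable
      (fun ξ : V => (((normWeight s o ((2 * π) • ξ))⁻¹ : ℝ) : ℂ) * h o ξ) volume := fun o =>
    (Complex.measurable_ofReal.comp
      ((measurable_normWeight o).inv.comp hc)).aestronglyMeasurable.mul (Lp.aestronglyMeasurable _)
  obtain ⟨u, hu⟩ := X.exists_hat_eq (P := P) (s := s)
    (fun o ξ => (((normWeight s o ((2 * π) • ξ))⁻¹ : ℝ) : ℂ) * h o ξ) hm
    (fun o => by
      refine (Lp.memLp (h o)).of_le_mul (c := 2) ((Complex.measurable_ofReal.comp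
        ((measurable_bracket _).comp hc)).aestronglyMeasurable.mul (hm o))
        (.of_forall fun ξ => ?_)
      have hw := normWeight_pos (s := s) o ((2 * π) • ξ)
      simp only [norm_mul, Complex.norm_real, Real.norm_eq_abs, abs_of_pos (bracket_pos _ _),
        abs_of_pos (inv_pos.2 hw)]
      rw [← mul_assoc]
      refine mul_le_mul_of_nonneg_right ?_ (norm_nonneg _)
      rw [← div_eq_mul_inv, div_le_iff₀ hw]
      exact bracket_le_normWeight o _)
    (fun o => by
      filter_upwards [hr o] with ξ h1
      rw [smul_neg, normWeight_neg, h1, map_mul, Complex.conj_ofReal])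
    (fun j k => by
      filter_upwards [hcurl j k] with ξ h1
      simp only [normWeight]
      linear_combination (((bracket s ((2 * π) • ξ) * (symK ((2 * π) • ξ))⁻¹)⁻¹ : ℝ) : ℂ) * h1)
  refine ⟨u, fun o => Lp.ext ?_⟩
  filter_upwards [u.coeFn_weighted o, hu o] with ξ h1 h2
  have hw := normWeight_pos (s := s) o ((2 * π) • ξ)
  rw [h1, h2, ← mul_assoc, ← Complex.ofReal_mul, mul_inv_cancel₀ hw.ne', Complex.ofReal_one,
    one_mul]

theorem X.hermitian_weighted (u : X P s) (o : Option ι) :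
    ∀ᵐ ξ : V, u.weighted o (-ξ) = (starRingEnd ℂ) (u.weighted o ξ) := by
  have h : ∀ᵐ x, (u.comp o x).im = 0 := by
    cases o
    · exact u.memX.real_eta
    · exact u.memX.real_vel _
  filter_upwards [u.coeFn_weighted o, ae_neg (u.coeFn_weighted o), (real_iff_hermitian _).1 h]
    with ξ h1 h2 h3
  rw [h1, h2, map_mul, Complex.conj_ofReal, smul_neg, normWeight_neg]
  exact congrArg _ h3

theorem X.curl_weighted (u : X P s) (j k : ι) :
    ∀ᵐ ξ : V, (P.e ((2 * π) • ξ) j : ℂ) * u.weighted (some k) ξ =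
      (P.e ((2 * π) • ξ) k : ℂ) * u.weighted (some j) ξ := by
  filter_upwards [u.coeFn_weighted (some j), u.coeFn_weighted (some k), u.memX.curl_free j k]
    with ξ h1 h2 h3
  rw [h1, h2]
  simp only [normWeight, X.comp, X.vel]
  linear_combination ((bracket s ((2 * π) • ξ) * (symK ((2 * π) • ξ))⁻¹ : ℝ) : ℂ) * h3

theorem memLp_top_e (P : Symbols V ι) (j : ι) :
    MemLp (fun ξ : V => (P.e ((2 * π) • ξ) j : ℂ)) ⊤ volume :=
  memLp_top_of_bound (Complex.measurable_ofReal.comp ((P.measurable_e j).comp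
    (measurable_const_smul _))).aestronglyMeasurable 1 (.of_forall fun ξ => by
      rw [Complex.norm_real]; exact P.abs_e_le _ _)

theorem continuous_lpSMul (c : Lp ℂ ⊤ (volume : Measure V)) :
    Continuous fun f : L2 V => (c • f : L2 V) :=
  (((ContinuousLinearMap.mul ℂ ℂ).holderL volume ⊤ 2 2) c).continuous

theorem coeFn_toLp_smul {c : V → ℂ} (hc : MemLp c ⊤ volume) (f : L2 V) :
    (hc.toLp • f : L2 V) =ᵐ[volume] fun ξ => c ξ * f ξ := by
  filter_upwards [Lp.coeFn_lpSMul (r := 2) hc.toLp f, hc.coeFn_toLp] with ξ h1 h2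
  rw [h1, Pi.smul_apply', h2, smul_eq_mul]

/-- Reflection and conjugation are continuous on `L²`, and the set is where they agree. -/
theorem isClosed_hermitian :
    IsClosed {f : L2 V | ∀ᵐ ξ : V, f (-ξ) = (starRingEnd ℂ) (f ξ)} := by
  have h : {f : L2 V | ∀ᵐ ξ : V, f (-ξ) = (starRingEnd ℂ) (f ξ)} =
      {f | Lp.compMeasurePreserving (fun ξ : V => -ξ) (Measure.measurePreserving_neg volume) f =
        (Complex.conjCLE : ℂ →L[ℝ] ℂ).compLp f} := by
    ext f
    simp only [Set.mem_ofPred_eq, Lp.ext_iff]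
    have h1 := Lp.coeFn_compMeasurePreserving f
        (Measure.measurePreserving_neg (volume : Measure V))
    have h2 := (Complex.conjCLE : ℂ →L[ℝ] ℂ).coeFn_compLp f
    constructor <;> intro h <;> filter_upwards [h, h1, h2] with ξ h3 h4 h5
    · rw [h4, h5]; exact h3
    · rw [h4, h5] at h3; exact h3
  rw [h]
  exact isClosed_eq (Lp.isometry_compMeasurePreserving _).continuous
    ((Complex.conjCLE : ℂ →L[ℝ] ℂ).compLpL 2 (volume : Measure V)).continuous

/-- The symbols `e_j` are bounded, so the relation equates two continuous maps into `L²`. -/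
theorem isClosed_curl (P : Symbols V ι) (j k : ι) :
    IsClosed {p : L2 V × L2 V | ∀ᵐ ξ : V, (P.e ((2 * π) • ξ) j : ℂ) * p.2 ξ =
      (P.e ((2 * π) • ξ) k : ℂ) * p.1 ξ} := by
  have h : {p : L2 V × L2 V | ∀ᵐ ξ : V, (P.e ((2 * π) • ξ) j : ℂ) * p.2 ξ =
      (P.e ((2 * π) • ξ) k : ℂ) * p.1 ξ} =
      {p | ((memLp_top_e P j).toLp • p.2 : L2 V) = ((memLp_top_e P k).toLp • p.1 : L2 V)} := by
    ext p
    simp only [Set.mem_ofPred_eq, Lp.ext_iff]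
    have h1 := coeFn_toLp_smul (memLp_top_e P j) p.2
    have h2 := coeFn_toLp_smul (memLp_top_e P k) p.1
    constructor <;> intro h <;> filter_upwards [h, h1, h2] with ξ h3 h4 h5
    · rw [h4, h5]; exact h3
    · rw [h4, h5] at h3; exact h3
  rw [h]
  exact isClosed_eq ((continuous_lpSMul _).comp continuous_snd)
    ((continuous_lpSMul _).comp continuous_fst)

theorem X.isometry_toHilbert : Isometry (X.toHilbert : X P s →ₗ[ℝ] _) :=
  AddMonoidHomClass.isometry_of_norm _ fun _ => rfl

/-- Completeness is needed for the contraction principle and the inverse function theorem. It also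
gives the integral in the Duhamel formula its meaning, since the Bochner integral is zero by
convention in an incomplete space. -/
instance : CompleteSpace (X P s) := by
  rw [completeSpace_iff_isComplete_range X.isometry_toHilbert.isUniformInducing]
  apply IsClosed.isComplete
  have h : Set.range (X.toHilbert : X P s →ₗ[ℝ] PiLp 2 (fun _ : Option ι => L2 V)) =
      (⋂ o, (fun h : PiLp 2 (fun _ : Option ι => L2 V) => h o) ⁻¹'
        {f : L2 V | ∀ᵐ ξ : V, f (-ξ) = (starRingEnd ℂ) (f ξ)}) ∩
      ⋂ j, ⋂ k, (fun h : PiLp 2 (fun _ : Option ι => L2 V) => (h (some j), h (some k))) ⁻¹'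
        {p : L2 V × L2 V | ∀ᵐ ξ : V, (P.e ((2 * π) • ξ) j : ℂ) * p.2 ξ =
      (P.e ((2 * π) • ξ) k : ℂ) * p.1 ξ} := by
    ext h
    simp only [Set.mem_range, Set.mem_inter_iff, Set.mem_iInter, Set.mem_preimage,
      Set.mem_ofPred_eq]
    constructor
    · rintro ⟨u, rfl⟩
      exact ⟨u.hermitian_weighted, u.curl_weighted⟩
    · rintro ⟨h1, h2⟩
      obtain ⟨u, hu⟩ := X.exists_weighted_eq (fun o => h o) h1 h2
      exact ⟨u, PiLp.ext hu⟩
  rw [h]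
  exact (isClosed_iInter fun o => isClosed_hermitian.preimage (by fun_prop)).inter
    (isClosed_iInter fun j => isClosed_iInter fun k => (isClosed_curl P j k).preimage
      (by fun_prop))

/-! ### Boundedness and strong continuity of `S(t)` -/

/-- The symbol of `S(t)` acting on the weighted Fourier transforms of the components. -/
def propWeighted (P : Symbols V ι) (t : ℝ) (ω : V) (W : Option ι → ℂ) : Option ι → ℂ
  | none => (Complex.exp (-Complex.I * t * P.m ω) + Complex.exp (Complex.I * t * P.m ω)) / 2 *
        W none +
      (Complex.exp (-Complex.I * t * P.m ω) - Complex.exp (Complex.I * t * P.m ω)) / 2 *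
        ∑ k, (P.e ω k : ℂ) * W (some k)
  | some j => P.e ω j *
      ((Complex.exp (-Complex.I * t * P.m ω) - Complex.exp (Complex.I * t * P.m ω)) / 2 *
        W none +
      (Complex.exp (-Complex.I * t * P.m ω) + Complex.exp (Complex.I * t * P.m ω)) / 2 *
        ∑ k, (P.e ω k : ℂ) * W (some k))

theorem propWeighted_add (t : ℝ) (ω : V) (W W' : Option ι → ℂ) (o : Option ι) :
    propWeighted P t ω (fun o => W o + W' o) o =
      propWeighted P t ω W o + propWeighted P t ω W' o := by
  cases o <;> simp only [propWeighted, mul_add, Finset.sum_add_distrib] <;> ring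

theorem propWeighted_smul (t : ℝ) (ω : V) (c : ℂ) (W : Option ι → ℂ) (o : Option ι) :
    propWeighted P t ω (fun o => c * W o) o = c * propWeighted P t ω W o := by
  cases o <;> simp only [propWeighted, mul_left_comm _ c, ← Finset.mul_sum] <;> ring

theorem norm_phase_add_le (x t : ℝ) :
    ‖(Complex.exp (-Complex.I * t * x) + Complex.exp (Complex.I * t * x)) / 2‖ ≤ 1 := by
  have h := norm_exp_phase x t
  rw [norm_div, Complex.norm_ofNat, div_le_one (by norm_num)]
  exact (norm_add_le _ _).trans (by rw [h.1, h.2]; norm_num)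

theorem norm_phase_sub_le (x t : ℝ) :
    ‖(Complex.exp (-Complex.I * t * x) - Complex.exp (Complex.I * t * x)) / 2‖ ≤ 1 := by
  have h := norm_exp_phase x t
  rw [norm_div, Complex.norm_ofNat, div_le_one (by norm_num)]
  exact (norm_sub_le _ _).trans (by rw [h.1, h.2]; norm_num)

/-- All entries of the matrix are products of some `e_j` with the cosine or `-i` times the sine of
`t m(ω)`, hence at most `1` in modulus. -/
theorem norm_propWeighted_le (t : ℝ) (ω : V) (W : Option ι → ℂ) (o : Option ι) :
    ‖propWeighted P t ω W o‖ ≤ ∑ o, ‖W o‖ := by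
  have h1 : ‖∑ k, (P.e ω k : ℂ) * W (some k)‖ ≤ ∑ k, ‖W (some k)‖ := by
    refine (norm_sum_le _ _).trans (Finset.sum_le_sum fun j _ => ?_)
    rw [norm_mul, Complex.norm_real]
    exact mul_le_of_le_one_left (norm_nonneg _) (P.abs_e_le ω j)
  have h2 : ∀ c d : ℂ, ‖c‖ ≤ 1 → ‖d‖ ≤ 1 →
      ‖c * W none + d * ∑ k, (P.e ω k : ℂ) * W (some k)‖ ≤ ∑ o, ‖W o‖ := fun c d hc hd => by
    rw [Fintype.sum_option]
    refine (norm_add_le _ _).trans (add_le_add ?_ ?_)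
    · rw [norm_mul]
      exact mul_le_of_le_one_left (norm_nonneg _) hc
    · rw [norm_mul]
      exact (mul_le_of_le_one_left (norm_nonneg _) hd).trans h1
  cases o with
  | none => exact h2 _ _ (norm_phase_add_le _ _) (norm_phase_sub_le _ _)
  | some j =>
    simp only [propWeighted, norm_mul (P.e ω j : ℂ), Complex.norm_real]
    exact (mul_le_of_le_one_left (norm_nonneg _) (P.abs_e_le ω j)).trans
      (h2 _ _ (norm_phase_sub_le _ _) (norm_phase_add_le _ _))

theorem continuous_propWeighted (ω : V) (W : Option ι → ℂ) (o : Option ι) :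
    Continuous fun t : ℝ => propWeighted P t ω W o := by
  cases o <;> simp only [propWeighted] <;> fun_prop

theorem X.hat_ofFourier_none {a : V → ℂ} {b : ι → V → ℂ} (hma hmb ha hb hra hrb hcurl) :
    hat (X.ofFourier (P := P) (s := s) a b hma hmb ha hb hra hrb hcurl).eta =ᵐ[volume] a := by
  have h := memLp_of_bracket_mul s.2 hma ha
  change hat (𝓕⁻ h.toLp) =ᵐ[volume] _
  exact hat_fourierInv_toLp h

theorem X.hat_ofFourier_some {a : V → ℂ} {b : ι → V → ℂ} (hma hmb ha hb hra hrb hcurl) (j : ι) :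
    hat ((X.ofFourier (P := P) (s := s) a b hma hmb ha hb hra hrb hcurl).vel j)
      =ᵐ[volume] b j := by
  have h := memLp_of_bracket_mul (by positivity) (hmb j) (hb j)
  change hat (𝓕⁻ h.toLp) =ᵐ[volume] _
  exact hat_fourierInv_toLp h

/-- The unbounded factor `K⁻¹` in `𝒦⁻¹` is absorbed by the velocity weight of the input, and the
factor `K` in `𝒦` cancels the `K⁻¹` in the velocity weight of the output. -/
theorem X.weighted_propagate (t : ℝ) (u : X P s) (o : Option ι) :
    (X.propagate t u).weighted o =ᵐ[volume] fun ξ =>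
      propWeighted P t ((2 * π) • ξ) (fun o => u.weighted o ξ) o := by
  have hall : ∀ᵐ ξ : V, ∀ o, u.weighted o ξ =
      ((normWeight s o ((2 * π) • ξ) : ℝ) : ℂ) * hat (u.comp o) ξ :=
    ae_all_iff.2 fun o => u.coeFn_weighted o
  have h2 : ((√2 : ℝ) : ℂ) * (√2 : ℝ) = 2 := by
    rw [← Complex.ofReal_mul, Real.mul_self_sqrt (by norm_num)]; norm_num
  have h3 : ((√2 : ℝ) : ℂ) ≠ 0 := Complex.ofReal_ne_zero.2 (by positivity)
  cases o with
  | none =>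
    filter_upwards [(X.propagate t u).coeFn_weighted none, X.hat_ofFourier_none (P := P) (s := s)
      (u.aesm_propEta t) (u.aesm_propVel t) (u.memLp_propEta t) (u.memLp_propVel t) _ _ _, hall]
      with ξ h4 h5 h6
    rw [h4]
    have h5' : hat ((X.propagate t u).comp none) ξ = _ := h5
    rw [h5']
    simp only [propWeighted, h6, normWeight, X.comp, propEta, diagonalize]
    have h7 : ∑ k, (P.e ((2 * π) • ξ) k : ℂ) *
        (((bracket s ((2 * π) • ξ) * (symK ((2 * π) • ξ))⁻¹ : ℝ) : ℂ) * hat (u.vel k) ξ) =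
        ((bracket s ((2 * π) • ξ) * (symK ((2 * π) • ξ))⁻¹ : ℝ) : ℂ) *
        ∑ k, (P.e ((2 * π) • ξ) k : ℂ) * hat (u.vel k) ξ := by
      rw [Finset.mul_sum]
      exact Finset.sum_congr rfl fun k _ => by ring
    -- Writing `2` as `√2 · √2` matches the two normalisations `1/√2` of `𝒦` and `𝒦⁻¹`.
    rw [h7, ← h2]
    push_cast
    field_simp
    ring
  | some j =>
    filter_upwards [(X.propagate t u).coeFn_weighted (some j), X.hat_ofFourier_some (P := P)
      (s := s) (u.aesm_propEta t) (u.aesm_propVel t) (u.memLp_propEta t) (u.memLp_propVel t)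
      _ _ _ j, hall] with ξ h4 h5 h6
    rw [h4]
    have h5' : hat ((X.propagate t u).comp (some j)) ξ = _ := h5
    rw [h5']
    simp only [propWeighted, h6, normWeight, X.comp, propVel, diagonalize]
    have h7 : ∑ k, (P.e ((2 * π) • ξ) k : ℂ) *
        (((bracket s ((2 * π) • ξ) * (symK ((2 * π) • ξ))⁻¹ : ℝ) : ℂ) * hat (u.vel k) ξ) =
        ((bracket s ((2 * π) • ξ) * (symK ((2 * π) • ξ))⁻¹ : ℝ) : ℂ) *
        ∑ k, (P.e ((2 * π) • ξ) k : ℂ) * hat (u.vel k) ξ := by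
      rw [Finset.mul_sum]
      exact Finset.sum_congr rfl fun k _ => by ring
    have hK : ((symK ((2 * π) • ξ) : ℝ) : ℂ) ≠ 0 := Complex.ofReal_ne_zero.2 (symK_pos _).ne'
    rw [h7, ← h2]
    push_cast
    field_simp
    ring

/-- A pointwise bound on the Fourier side gives a norm bound. One factor of the cardinality comes
from the pointwise sum, the other from bounding the norm of `w` by the sum over its components; the
cruder constant replaces `1`, which is harmless here. -/
theorem X.norm_le_of_weighted_le {u w : X P s}
    (h : ∀ o, ∀ᵐ ξ : V, ‖w.weighted o ξ‖ ≤ ∑ o, ‖u.weighted o ξ‖) :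
    ‖w‖ ≤ (Fintype.card (Option ι)) ^ 2 * ‖u‖ := by
  set G : Lp ℝ 2 (volume : Measure V) := ∑ o, (Lp.memLp (u.weighted o)).norm.toLp with hG
  have hGn : ‖G‖ ≤ Fintype.card (Option ι) * ‖u‖ := by
    refine (norm_sum_le_of_le (n := fun _ => ‖u‖) _ fun o _ => ?_).trans (by simp)
    rw [Lp.norm_toLp, eLpNorm_norm, ← Lp.norm_def]
    exact u.norm_weighted_le o
  have hGc : ∀ᵐ ξ : V, G ξ = ∑ o, ‖u.weighted o ξ‖ := by
    filter_upwards [Lp.coeFn_finsetSum Finset.univ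
      (fun o => (Lp.memLp (u.weighted o)).norm.toLp),
      ae_all_iff.2 fun o => (Lp.memLp (u.weighted o)).norm.coeFn_toLp] with ξ h1 h2
    rw [hG, h1, Finset.sum_apply]
    exact Finset.sum_congr rfl fun o _ => h2 o
  refine w.norm_le_sum.trans ((Finset.sum_le_sum (g := fun _ => Fintype.card (Option ι) * ‖u‖)
    fun o _ => ?_).trans (le_of_eq ?_))
  · refine (Lp.norm_le_norm_of_ae_le ?_).trans hGn
    filter_upwards [h o, hGc] with ξ h1 h2
    rw [h2]
    exact h1.trans (le_abs_self _)
  · simp; ring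

/-- `S(t)` as a bounded operator on `X^s`. -/
def X.propagator (P : Symbols V ι) (s : ℝ≥0) (t : ℝ) : X P s →L[ℝ] X P s :=
  LinearMap.mkContinuous
    { toFun := X.propagate t
      map_add' := fun u w => X.weighted_injective fun o => Lp.ext (by
        rw [X.weighted_add]
        filter_upwards [X.weighted_propagate t (u + w) o, X.weighted_propagate t u o,
          X.weighted_propagate t w o, Lp.coeFn_add ((X.propagate t u).weighted o)
            ((X.propagate t w).weighted o), ae_all_iff.2 fun o =>
            Lp.coeFn_add (u.weighted o) (w.weighted o)] with ξ h1 h2 h3 h4 h5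
        rw [h1, h4, Pi.add_apply, h2, h3, ← propWeighted_add]
        congr 1
        ext o
        rw [X.weighted_add, h5, Pi.add_apply])
      map_smul' := fun c u => X.weighted_injective fun o => Lp.ext (by
        rw [RingHom.id_apply, X.weighted_smul]
        filter_upwards [X.weighted_propagate t (c • u) o, X.weighted_propagate t u o,
          Lp.coeFn_smul c ((X.propagate t u).weighted o), ae_all_iff.2 fun o =>
            Lp.coeFn_smul c (u.weighted o)] with ξ h1 h2 h4 h5
        rw [h1, h4, Pi.smul_apply, h2, Complex.real_smul, ← propWeighted_smul]
        congr 1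
        ext o
        rw [X.weighted_smul, h5, Pi.smul_apply, Complex.real_smul]) }
    ((Fintype.card (Option ι)) ^ 2) fun u => X.norm_le_of_weighted_le fun o => by
      filter_upwards [X.weighted_propagate t u o] with ξ h1
      exact h1 ▸ norm_propWeighted_le _ _ _ _

theorem X.propagator_apply (t : ℝ) (u : X P s) : X.propagator P s t u = X.propagate t u := rfl

theorem X.norm_propagator_le (t : ℝ) :
    ‖X.propagator P s t‖ ≤ (Fintype.card (Option ι)) ^ 2 :=
  LinearMap.mkContinuous_norm_le _ (by positivity) _

/-- Dominated convergence in `L²`, along sequences of times. It yields strong continuity of `S(t)`,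
whose symbol is continuous in `t` for each frequency and dominated uniformly in `t`. -/
theorem continuous_Lp_of_dominated {F : ℝ → L2 V} {f : ℝ → V → ℂ} {g : V → ℝ}
    (hF : ∀ t, F t =ᵐ[volume] f t) (hg : MemLp g 2 volume)
    (hb : ∀ t, ∀ᵐ ξ, ‖f t ξ‖ ≤ g ξ) (hc : ∀ᵐ ξ, Continuous fun t => f t ξ) : Continuous F := by
  rw [continuous_iff_continuousAt]
  intro t
  refine tendsto_of_seq_tendsto fun x hx => ?_
  rw [Lp.tendsto_Lp_iff_tendsto_eLpNorm']
  simp only [eLpNorm_eq_lintegral_rpow_enorm_toReal two_ne_zero ENNReal.ofNat_ne_top,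
    ENNReal.toReal_ofNat, Pi.sub_apply, Function.comp_apply]
  have h0 : (0 : ENNReal) = (∫⁻ ξ : V, 0) ^ (1 / 2 : ℝ) := by simp
  rw [h0]
  refine Tendsto.ennrpow_const _ ?_
  have hfin := (hg.const_mul 2).eLpNorm_lt_top
  rw [eLpNorm_lt_top_iff_lintegral_rpow_enorm_lt_top two_ne_zero ENNReal.ofNat_ne_top,
    ENNReal.toReal_ofNat] at hfin
  -- The difference of two values of `f` is bounded by `2g`, so `|2g|²` is the integrable majorant.
  refine tendsto_lintegral_of_dominated_convergence' (fun ξ => ‖2 * g ξ‖ₑ ^ (2 : ℝ))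
    (fun n => ?_) (fun n => ?_) hfin.ne ?_
  · exact ((Lp.aestronglyMeasurable _).sub (Lp.aestronglyMeasurable _)).enorm.pow_const _
  · filter_upwards [hF (x n), hF t, hb (x n), hb t] with ξ h1 h2 h3 h4
    gcongr
    rw [h1, h2, enorm_le_iff_norm_le]
    refine (norm_sub_le _ _).trans (le_trans ?_ (le_abs_self _))
    linarith
  · filter_upwards [ae_all_iff.2 fun n => hF (x n), hF t, hc] with ξ h1 h2 h3
    simp only [h1, h2]
    have h4 : Tendsto (fun n => f (x n) ξ - f t ξ) atTop (𝓝 0) := by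
      have := ((h3.tendsto t).comp hx).sub_const (f t ξ)
      rwa [sub_self] at this
    have h5 := (h4.enorm.ennrpow_const 2)
    simpa using h5

theorem X.continuous_propagator (u : X P s) : Continuous fun t => X.propagator P s t u := by
  have hcomp : ∀ o, Continuous fun t => (X.propagate t u).weighted o := fun o =>
    continuous_Lp_of_dominated (g := fun ξ => ∑ o, ‖u.weighted o ξ‖)
      (fun t => X.weighted_propagate t u o)
      (memLp_finsetSum _ fun o _ => (Lp.memLp (u.weighted o)).norm)
      (fun t => .of_forall fun ξ => norm_propWeighted_le _ _ _ _)
      (.of_forall fun ξ => continuous_propWeighted _ _ _)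
  exact X.isometry_toHilbert.isUniformInducing.isInducing.continuous_iff.2
    ((PiLp.continuous_toLp 2 _).comp (continuous_pi hcomp))

/-! ### The Fourier transform of a product of two `L²` functions -/

theorem integrable_mul_L2 (f g : L2 V) : Integrable (fun x => f x * g x) volume :=
  (Lp.memLp f).integrable_mul (Lp.memLp g)

theorem fourier_fourier_schwartz (f : 𝓢(V, ℂ)) (x : V) : 𝓕 (𝓕 f) x = f (-x) := by
  have h : 𝓕⁻ (𝓕 f) (-x) = f (-x) := by rw [FourierTransform.fourierInv_fourier_eq]
  rw [← h, SchwartzMap.fourier_coe (𝓕 f), SchwartzMap.fourierInv_coe,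
    Real.fourierInv_eq_fourier_neg, neg_neg]

theorem fourier_mul_schwartz (f g : 𝓢(V, ℂ)) (ξ : V) :
    𝓕 (fun x => f x * g x) ξ = ∫ ζ, 𝓕 f ζ * 𝓕 g (ξ - ζ) := by
  have h1 : SchwartzMap.convolution (ContinuousLinearMap.mul ℂ ℂ) (𝓕 f) (𝓕 g) ξ =
      ∫ ζ, 𝓕 f ζ * 𝓕 g (ξ - ζ) := by
    rw [SchwartzMap.convolution_apply]
    rfl
  -- The convolution theorem is applied to `𝓕 f` and `𝓕 g`; since `𝓕 𝓕` is reflection, it yields the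
  -- formula for `fg` after the substitution `x ↦ -x`.
  have h2 : SchwartzMap.convolution (ContinuousLinearMap.mul ℂ ℂ) (𝓕 f) (𝓕 g) =
      𝓕⁻ (SchwartzMap.pairing (ContinuousLinearMap.mul ℂ ℂ) (𝓕 (𝓕 f)) (𝓕 (𝓕 g))) := by
    rw [← SchwartzMap.fourier_convolution, FourierTransform.fourierInv_fourier_eq]
  rw [← h1, h2, SchwartzMap.fourierInv_coe, Real.fourierInv_eq, Real.fourier_eq,
    ← integral_neg_eq_self]
  congr 1
  ext x
  simp [SchwartzMap.pairing_apply_apply, fourier_fourier_schwartz]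

/-- The character `x ↦ e^{-2πi⟨x, ξ⟩}` is bounded. -/
theorem memLp_top_char (ξ : V) :
    MemLp (fun x : V => ((Real.fourierChar (-inner ℝ x ξ) : Circle) : ℂ)) ⊤ volume :=
  memLp_top_of_bound (Continuous.aestronglyMeasurable (by fun_prop)) 1 (.of_forall fun x =>
    (Circle.norm_coe _).le)

/-- Fixing `ξ` and absorbing the character into `f` exhibits the value as a bounded bilinear pairing
on `L²`. This gives both the continuity required for the density argument and the bilinearity of the
forcing. -/
theorem fourier_mul_eq_lpPairing (f g : L2 V) (ξ : V) :
    𝓕 (fun x => f x * g x) ξ = (ContinuousLinearMap.mul ℂ ℂ).lpPairing volume 2 2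
      ((memLp_top_char ξ).toLp • f : L2 V) g := by
  rw [ContinuousLinearMap.lpPairing_eq_integral, Real.fourier_eq]
  refine integral_congr_ae ?_
  filter_upwards [coeFn_toLp_smul (memLp_top_char ξ) f] with x h
  rw [ContinuousLinearMap.mul_apply', h, mul_assoc]
  rfl

theorem integral_mul_translate_eq_lpPairing (F G : L2 V) (ξ : V) :
    ∫ ζ, F ζ * G (ξ - ζ) = (ContinuousLinearMap.mul ℂ ℂ).lpPairing volume 2 2 F
      (Lp.compMeasurePreserving (fun ζ : V => ξ - ζ) (Measure.measurePreserving_sub_left volume ξ)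
        G) := by
  rw [ContinuousLinearMap.lpPairing_eq_integral]
  refine integral_congr_ae ?_
  filter_upwards [Lp.coeFn_compMeasurePreserving G
    (Measure.measurePreserving_sub_left volume ξ)] with x h
  rw [ContinuousLinearMap.mul_apply', h]
  rfl

/-- The Fourier transform of a product of `L²` functions is the convolution of their Fourier
transforms. -/
theorem fourier_mul_L2 (f g : L2 V) (ξ : V) :
    𝓕 (fun x => f x * g x) ξ = ∫ ζ, hat f ζ * hat g (ξ - ζ) := by
  unfold hat
  -- For fixed `ξ` both sides are continuous in `(f, g)` on `L² × L²`, so Schwartz functions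
  -- suffice.
  refine DenseRange.induction_on₂
    (p := fun f g : L2 V => 𝓕 (fun x => f x * g x) ξ =
      ∫ ζ, (𝓕 f : L2 V) ζ * (𝓕 g : L2 V) (ξ - ζ))
    (SchwartzMap.denseRange_toLpCLM (p := 2) (F := ℂ) (μ := (volume : Measure V))
      ENNReal.ofNat_ne_top) ?_ ?_ f g
  · refine isClosed_eq ?_ ?_
    · simp only [fourier_mul_eq_lpPairing]
      generalize (ContinuousLinearMap.mul ℂ ℂ).lpPairing (volume : Measure V) 2 2 = B
      exact (B.continuous.comp ((continuous_lpSMul _).comp continuous_fst)).clm_apply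
        continuous_snd
    · simp only [integral_mul_translate_eq_lpPairing]
      generalize (ContinuousLinearMap.mul ℂ ℂ).lpPairing (volume : Measure V) 2 2 = B
      exact (B.continuous.comp ((Lp.fourierTransformₗᵢ V ℂ).continuous.comp
        continuous_fst)).clm_apply ((Lp.isometry_compMeasurePreserving _).continuous.comp
            ((Lp.fourierTransformₗᵢ V ℂ).continuous.comp continuous_snd))
  · intro f g
    have h1 : 𝓕 (fun x => (f.toLp 2 (volume : Measure V)) x * (g.toLp 2 (volume : Measure V)) x) ξ
        = 𝓕 (fun x => f x * g x) ξ := by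
      rw [Real.fourier_eq, Real.fourier_eq]
      refine integral_congr_ae ?_
      filter_upwards [f.coeFn_toLp 2 (volume : Measure V), g.coeFn_toLp 2 (volume : Measure V)]
        with x h1 h2
      rw [h1, h2]
    refine (h1.trans (fourier_mul_schwartz f g ξ)).trans ?_
    simp only [SchwartzMap.toLpCLM_apply, SchwartzMap.toLp_fourier_eq]
    refine integral_congr_ae ?_
    filter_upwards [(𝓕 f).coeFn_toLp 2 (volume : Measure V),
      (Measure.measurePreserving_sub_left (volume : Measure V) ξ).quasiMeasurePreserving.ae
        ((𝓕 g).coeFn_toLp 2 (volume : Measure V))] with x h1 h2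
    rw [h1, h2]

theorem continuous_fourier_mul (f g : L2 V) : Continuous (𝓕 fun x => f x * g x) :=
  VectorFourier.fourierIntegral_continuous Real.continuous_fourierChar
    (by exact continuous_inner) (integrable_mul_L2 f g)

/-! ### Young's inequality and the Sobolev product estimate -/

theorem lintegral_mul_le_sqrt {α : Type*} [MeasurableSpace α] {μ : Measure α} {f g : α → ℝ≥0∞}
    (hf : AEMeasurable f μ) (hg : AEMeasurable g μ) :
    ∫⁻ x, f x * g x ∂μ ≤ eLpNorm f 2 μ * eLpNorm g 2 μ := by
  simpa [eLpNorm_eq_lintegral_rpow_enorm_toReal] using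
    ENNReal.lintegral_mul_le_Lp_mul_Lq μ Real.HolderConjugate.two_two hf hg

theorem eLpNorm_two_sq {α : Type*} [MeasurableSpace α] {μ : Measure α} (f : α → ℝ≥0∞) :
    eLpNorm f 2 μ ^ 2 = ∫⁻ x, f x ^ 2 ∂μ := by
  have := eLpNorm_nnreal_pow_eq_lintegral (μ := μ) (f := f) (p := 2) two_ne_zero
  simpa using this

/-- Young's inequality `L¹ * L² ⊂ L²`. -/
theorem eLpNorm_lconvolution_le {a b : V → ℝ≥0∞} (ha : AEMeasurable a volume)
    (hb : AEMeasurable b volume) :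
    eLpNorm (a ⋆ₗ b) 2 volume ≤ (∫⁻ x, a x) * eLpNorm b 2 volume := by
  rw [← ENNReal.pow_le_pow_left_iff two_ne_zero, mul_pow, eLpNorm_two_sq, eLpNorm_two_sq]
  -- Cauchy–Schwarz with the splitting `a = a^{1/2} a^{1/2}`, that is, in the measure `a(y) dy`.
  -- Tonelli and translation invariance then finish the proof.
  have hpt : ∀ x, (a ⋆ₗ b) x ^ 2 ≤ (∫⁻ x, a x) * ∫⁻ y, a y * b (-y + x) ^ 2 := by
    intro x
    have hbx : AEMeasurable (fun y => b (-y + x)) volume := by fun_prop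
    have e : ∀ y, a y ^ (1 / 2 : ℝ) * a y ^ (1 / 2 : ℝ) = a y := fun y => by
      rw [← ENNReal.rpow_add_of_nonneg _ _ (by norm_num) (by norm_num)]; norm_num
    have h := lintegral_mul_le_sqrt (ha.pow_const (1 / 2 : ℝ))
      ((ha.pow_const (1 / 2 : ℝ)).mul hbx)
    have h2 := pow_le_pow_left₀ zero_le h 2
    rw [mul_pow, eLpNorm_two_sq, eLpNorm_two_sq] at h2
    simp only [Pi.mul_apply, mul_pow, ← mul_assoc, e, sq (a _ ^ (1 / 2 : ℝ))] at h2
    exact h2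
  refine (lintegral_mono hpt).trans ?_
  have hb2 : AEMeasurable (fun x => b x ^ 2) volume := hb.pow_const 2
  have hconv : AEMeasurable (fun x => ∫⁻ y, a y * b (-y + x) ^ 2) volume :=
    aemeasurable_lconvolution ha hb2
  rw [lintegral_const_mul'' _ hconv, lintegral_lintegral_swap, sq,
    mul_assoc]
  · gcongr
    refine le_of_eq ?_
    calc ∫⁻ y, ∫⁻ x, a y * b (-y + x) ^ 2 = ∫⁻ y, a y * ∫⁻ x, b x ^ 2 := by
          refine lintegral_congr fun y => ?_
          rw [lintegral_const_mul'' _ (by fun_prop),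
            lintegral_add_left_eq_self (fun x => b x ^ 2) (-y)]
      _ = _ := lintegral_mul_const'' _ ha
  · fun_prop

theorem eLpNorm_lconvolution_le' {a b : V → ℝ≥0∞} (ha : AEMeasurable a volume)
    (hb : AEMeasurable b volume) :
    eLpNorm (a ⋆ₗ b) 2 volume ≤ eLpNorm a 2 volume * ∫⁻ x, b x := by
  rw [lconvolution_comm, mul_comm]
  exact eLpNorm_lconvolution_le hb ha

/-- Here `1 + ‖a + b‖² ≤ 4 (1 + ‖a‖²)`, and raising this to the power `r/2` gives the factor
`4^{r/2} = 2^r`. -/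
theorem bracket_add_le_of_norm_le {r : ℝ} (hr : 0 ≤ r) {a b : V} (h : ‖b‖ ≤ ‖a‖) :
    bracket r (a + b) ≤ 2 ^ r * bracket r a := by
  have e : (2 : ℝ) ^ r = 4 ^ (r / 2) := by
    rw [show (4 : ℝ) = 2 ^ (2 : ℝ) by norm_num, ← Real.rpow_mul (by norm_num)]
    congr 1; ring
  unfold bracket
  rw [e, ← Real.mul_rpow (by norm_num) (by positivity)]
  refine Real.rpow_le_rpow (by positivity) ?_ (by positivity)
  have h1 := norm_add_le a b
  nlinarith [norm_nonneg (a + b), norm_nonneg a, norm_nonneg b]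

theorem bracket_anti {r : ℝ} (hr : r ≤ 0) {a b : V} (h : ‖a‖ ≤ ‖b‖) :
    bracket r b ≤ bracket r a := by
  unfold bracket
  exact Real.rpow_le_rpow_of_nonpos (by positivity) (by gcongr) (by linarith)

theorem bracket_mul_bracket_neg (r : ℝ) (a : V) : bracket r a * bracket (-r) a = 1 := by
  rw [← bracket_add]; simp [bracket]

/-- The larger frequency carries the derivatives. If it is `a`, the second summand already suffices;
if it is `b`, write `⟨b⟩^r = ⟨b⟩^{r-σ} ⟨b⟩^σ` and use `r - σ ≤ 0` to replace `⟨b⟩^{r-σ}` by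
`⟨a⟩^{r-σ}`. In either case a square-integrable factor `⟨·⟩^{-σ}` is left over. -/
theorem bracket_add_le {r σ : ℝ} (hr : 0 ≤ r) (hrσ : r ≤ σ) (a b : V) :
    bracket r (a + b) ≤
      2 ^ r * (bracket r a * bracket σ b * (bracket (-σ) a + bracket (-σ) b)) := by
  have ha := bracket_pos r a
  have hb := bracket_pos σ b
  have ha' := bracket_pos (-σ) a
  have hb' := bracket_pos (-σ) b
  rcases le_total ‖b‖ ‖a‖ with h | h
  · refine (bracket_add_le_of_norm_le hr h).trans ?_
    gcongr
    have e : bracket r a * bracket σ b * (bracket (-σ) a + bracket (-σ) b) =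
        bracket r a * bracket σ b * bracket (-σ) a +
          bracket r a * (bracket σ b * bracket (-σ) b) := by ring
    rw [e, bracket_mul_bracket_neg, mul_one]
    have : 0 ≤ bracket r a * bracket σ b * bracket (-σ) a := by positivity
    linarith
  · rw [add_comm a b]
    refine (bracket_add_le_of_norm_le hr h).trans ?_
    gcongr
    have h1 : bracket r b = bracket (r - σ) b * bracket σ b := by
      rw [← bracket_add]; congr 1; ring
    have h2 : bracket (r - σ) b ≤ bracket r a * bracket (-σ) a := by
      rw [← bracket_add, ← sub_eq_add_neg]
      exact bracket_anti (by linarith) h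
    calc bracket r b ≤ bracket r a * bracket (-σ) a * bracket σ b := by rw [h1]; gcongr
      _ = bracket r a * bracket σ b * bracket (-σ) a := by ring
      _ ≤ _ := by gcongr; linarith

/-- `‖⟨D⟩^r f‖ₑ` on the Fourier side. -/
def bracketHat (r : ℝ) (f : L2 V) (ξ : V) : ℝ≥0∞ :=
  ‖((bracket r ((2 * π) • ξ) : ℝ) : ℂ) * hat f ξ‖ₑ

theorem aemeasurable_bracketHat (r : ℝ) (f : L2 V) :
    AEMeasurable (bracketHat r f) volume :=
  (aestronglyMeasurable_mul_hat (measurable_bracket r) f).enorm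

/-- The weight `⟨2πξ⟩^{-σ}`. -/
def negWeight (σ : ℝ) (ξ : V) : ℝ≥0∞ := ‖bracket (-σ) ((2 * π) • ξ)‖ₑ

theorem measurable_negWeight (σ : ℝ) : Measurable (negWeight σ : V → ℝ≥0∞) :=
  ((measurable_bracket (-σ)).comp (measurable_const_smul (2 * π))).enorm

/-- `⟨ω⟩^{-2σ}` is integrable exactly when `2σ` exceeds the dimension; this is where the lower bound
on `s` enters. The dilation by `2π` only decreases the weight. -/
theorem eLpNorm_negWeight_lt_top {σ : ℝ} (hσ : (Module.finrank ℝ V : ℝ) < 2 * σ) :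
    eLpNorm (negWeight σ : V → ℝ≥0∞) 2 volume < ⊤ := by
  have hσ0 : 0 < σ := by
    have : (0 : ℝ) ≤ Module.finrank ℝ V := Nat.cast_nonneg _
    linarith
  have h1 : MemLp (bracket (-σ) : V → ℝ) 2 volume := by
    rw [memLp_two_iff_integrable_sq (measurable_bracket _).aestronglyMeasurable]
    refine (integrable_rpow_neg_one_add_norm_sq hσ).congr (.of_forall fun x => ?_)
    simp only [bracket]
    rw [← Real.rpow_mul_natCast (by positivity)]
    congr 1; push_cast; ring
  refine lt_of_le_of_lt (eLpNorm_mono_enorm (g := (bracket (-σ) : V → ℝ)) fun ξ => ?_)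
    h1.eLpNorm_lt_top
  rw [enorm_eq_self, negWeight, enorm_le_iff_norm_le, Real.norm_of_nonneg (bracket_pos _ _).le,
    Real.norm_of_nonneg (bracket_pos _ _).le]
  refine bracket_anti (by linarith) ?_
  rw [norm_smul, Real.norm_of_nonneg (by positivity)]
  nlinarith [Real.pi_gt_three, norm_nonneg ξ]

theorem enorm_bracket_mul_fourier_le {r σ : ℝ} (hr : 0 ≤ r) (hrσ : r ≤ σ) (f g : L2 V) (ξ : V) :
    ‖((bracket r ((2 * π) • ξ) : ℝ) : ℂ) * 𝓕 (fun x => f x * g x) ξ‖ₑ ≤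
      ‖(2 : ℝ) ^ r‖ₑ * (((fun ζ => bracketHat r f ζ * negWeight σ ζ) ⋆ₗ bracketHat σ g) ξ +
        (bracketHat r f ⋆ₗ fun ζ => bracketHat σ g ζ * negWeight σ ζ) ξ) := by
  rw [fourier_mul_L2, enorm_mul]
  refine (mul_le_mul_right (enorm_integral_le_lintegral_enorm _) _).trans ?_
  have hq : Measure.QuasiMeasurePreserving (fun ζ : V => -ζ + ξ) volume volume := by
    have := (Measure.measurePreserving_sub_left (volume : Measure V) ξ).quasiMeasurePreserving
    simpa only [sub_eq_neg_add] using this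
  have hF := aemeasurable_bracketHat r f
  have hG := (aemeasurable_bracketHat σ g).comp_quasiMeasurePreserving hq
  have hW := (measurable_negWeight (V := V) σ)
  have hm : AEMeasurable (fun ζ => bracketHat r f ζ * negWeight σ ζ *
      bracketHat σ g (-ζ + ξ)) volume := (hF.mul hW.aemeasurable).mul hG
  rw [lconvolution_def, lconvolution_def, ← lintegral_add_left' hm,
    ← lintegral_const_mul' _ _ enorm_ne_top, ← lintegral_const_mul' _ _ enorm_ne_top]
  refine lintegral_mono fun ζ => ?_
  rw [show ξ - ζ = -ζ + ξ by abel]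
  -- The bracket inequality is used at the frequencies `ζ` and `ξ - ζ` of the two factors inside the
  -- convolution.
  have key := ENNReal.ofReal_le_ofReal
    (bracket_add_le hr hrσ ((2 * π) • ζ) ((2 * π) • (-ζ + ξ)))
  rw [← smul_add, add_neg_cancel_left] at key
  have hpos := fun t (ω : V) => (bracket_pos t ω).le
  rw [ENNReal.ofReal_mul (by positivity),
    ENNReal.ofReal_mul (mul_nonneg (hpos _ _) (hpos _ _)), ENNReal.ofReal_mul (hpos _ _),
    ENNReal.ofReal_add (hpos _ _) (hpos _ _)] at key
  have hC : ∀ t (ω : V), ‖((bracket t ω : ℝ) : ℂ)‖ₑ = ENNReal.ofReal (bracket t ω) := fun t ω => by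
    rw [← ofReal_norm, Complex.norm_real, Real.norm_of_nonneg (hpos t ω)]
  simp only [bracketHat, negWeight, enorm_mul, hC, Real.enorm_of_nonneg (hpos _ _),
    Real.enorm_of_nonneg (show (0 : ℝ) ≤ 2 ^ r by positivity)]
  refine (mul_le_mul_left key _).trans (le_of_eq ?_)
  ring

/-- The product estimate `H^r · H^σ ⊂ H^r`. In each of the two convolutions the factor carrying
`⟨·⟩^{-σ}` is in `L¹` by Cauchy–Schwarz and the other is in `L²`, so Young's inequality applies; the
factor `2` in the constant counts the two convolutions. -/
theorem exists_eLpNorm_fourier_mul_le {r σ : ℝ} (hr : 0 ≤ r) (hrσ : r ≤ σ)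
    (hσ : (Module.finrank ℝ V : ℝ) < 2 * σ) :
    ∃ C : ℝ≥0, ∀ f g : L2 V,
      eLpNorm (fun ξ => ((bracket r ((2 * π) • ξ) : ℝ) : ℂ) * 𝓕 (fun x => f x * g x) ξ) 2 volume ≤
        C * (eLpNorm (fun ξ => ((bracket r ((2 * π) • ξ) : ℝ) : ℂ) * hat f ξ) 2 volume *
          eLpNorm (fun ξ => ((bracket σ ((2 * π) • ξ) : ℝ) : ℂ) * hat g ξ) 2 volume) := by
  have hW := eLpNorm_negWeight_lt_top (V := V) hσ
  refine ⟨‖(2 : ℝ) ^ r‖₊ * (2 * (eLpNorm (negWeight σ : V → ℝ≥0∞) 2 volume).toNNReal),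
    fun f g => ?_⟩
  have hF := aemeasurable_bracketHat r f
  have hG := aemeasurable_bracketHat σ g
  have hWm := (measurable_negWeight (V := V) σ).aemeasurable (μ := volume)
  have eF : eLpNorm (fun ξ => ((bracket r ((2 * π) • ξ) : ℝ) : ℂ) * hat f ξ) 2 volume =
    eLpNorm (bracketHat r f) 2 volume := (eLpNorm_enorm _).symm
  have eG : eLpNorm (fun ξ => ((bracket σ ((2 * π) • ξ) : ℝ) : ℂ) * hat g ξ) 2 volume =
    eLpNorm (bracketHat σ g) 2 volume := (eLpNorm_enorm _).symm
  rw [eF, eG]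
  have h1 := (eLpNorm_lconvolution_le (hF.mul hWm) hG).trans
    (mul_le_mul_left (lintegral_mul_le_sqrt hF hWm) _)
  have h2 := (eLpNorm_lconvolution_le' hF (hG.mul hWm)).trans
    (mul_le_mul_right (lintegral_mul_le_sqrt hG hWm) _)
  have hc1 : AEMeasurable ((fun ζ => bracketHat r f ζ * negWeight σ ζ) ⋆ₗ bracketHat σ g)
    volume := aemeasurable_lconvolution (hF.mul hWm) hG
  have hc2 : AEMeasurable (bracketHat r f ⋆ₗ fun ζ => bracketHat σ g ζ * negWeight σ ζ)
    volume := aemeasurable_lconvolution hF (hG.mul hWm)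
  have h3 := eLpNorm_add_le (p := 2) hc1.aestronglyMeasurable hc2.aestronglyMeasurable
    (by norm_num)
  refine (eLpNorm_le_nnreal_smul_eLpNorm_of_ae_le_mul' (c := ‖(2 : ℝ) ^ r‖₊)

    (g := ((fun ζ => bracketHat r f ζ * negWeight σ ζ) ⋆ₗ bracketHat σ g) +
      (bracketHat r f ⋆ₗ fun ζ => bracketHat σ g ζ * negWeight σ ζ)) (.of_forall fun ξ => by
      rw [enorm_eq_self]
      exact enorm_bracket_mul_fourier_le hr hrσ f g ξ) 2).trans ?_
  rw [ENNReal.smul_def, smul_eq_mul]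
  refine (mul_le_mul_right (h3.trans (add_le_add h1 h2)) _).trans (le_of_eq ?_)
  push_cast
  rw [ENNReal.coe_toNNReal hW.ne]
  ring

/-! ### The forcing term as a bounded bilinear map -/

/-- The properties of the symbol `g` of the nonlinearity used in the product estimates. -/
structure Symbols.IsAdmissible (P : Symbols V ι) : Prop where
  measurable_g : ∀ j, Measurable fun ω => P.g ω j
  abs_g_le : ∀ ω j, |P.g ω j| ≤ 1
  g_neg : ∀ ω j, P.g (-ω) j = -P.g ω j
  e_mul_g : ∀ ω j k, P.e ω j * P.g ω k = P.e ω k * P.g ω j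

theorem fourier_mul_add_right (f g g' : L2 V) (ξ : V) :
    𝓕 (fun x => f x * (g + g') x) ξ =
      𝓕 (fun x => f x * g x) ξ + 𝓕 (fun x => f x * g' x) ξ := by
  simp only [fourier_mul_eq_lpPairing, map_add]

theorem fourier_mul_smul_right (c : ℝ) (f g : L2 V) (ξ : V) :
    𝓕 (fun x => f x * (c • g) x) ξ = c * 𝓕 (fun x => f x * g x) ξ := by
  rw [fourier_mul_eq_lpPairing, fourier_mul_eq_lpPairing, ← Complex.real_smul]
  exact LinearMap.map_smul_of_tower (((ContinuousLinearMap.mul ℂ ℂ).lpPairing volume 2 2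
    ((memLp_top_char ξ).toLp • f : L2 V)).toLinearMap) c g

theorem fourier_mul_comm (f g : L2 V) (ξ : V) :
    𝓕 (fun x => f x * g x) ξ = 𝓕 (fun x => g x * f x) ξ := by
  simp only [mul_comm]

theorem fourier_mul_add_left (f f' g : L2 V) (ξ : V) :
    𝓕 (fun x => (f + f') x * g x) ξ =
      𝓕 (fun x => f x * g x) ξ + 𝓕 (fun x => f' x * g x) ξ := by
  rw [fourier_mul_comm, fourier_mul_add_right, fourier_mul_comm g, fourier_mul_comm g]

theorem fourier_mul_smul_left (c : ℝ) (f g : L2 V) (ξ : V) :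
    𝓕 (fun x => (c • f) x * g x) ξ = c * 𝓕 (fun x => f x * g x) ξ := by
  rw [fourier_mul_comm, fourier_mul_smul_right, fourier_mul_comm g]

theorem fourier_mul_neg {f g : L2 V} (hf : ∀ᵐ x, (f x).im = 0) (hg : ∀ᵐ x, (g x).im = 0)
    (ξ : V) : 𝓕 (fun x => f x * g x) (-ξ) = (starRingEnd ℂ) (𝓕 (fun x => f x * g x) ξ) := by
  rw [Real.fourier_eq', Real.fourier_eq', ← integral_conj]
  refine integral_congr_ae ?_
  filter_upwards [hf, hg] with x h1 h2
  simp [← Complex.exp_conj, Complex.conj_ofNat, Complex.conj_eq_iff_im.2 h1,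
    Complex.conj_eq_iff_im.2 h2]

/-- The component of `u` that multiplies `w.vel j` in the forcing term: `η` in the first row, `v_j`
in the others. -/
def forcingIndex : Option ι → ι → Option ι
  | none, _ => none
  | some _, j => some j

/-- The symbol in front of the products in the forcing term. -/
def forcingSymbol (P : Symbols V ι) (ω : V) : Option ι → ι → ℝ
  | none, j => P.g ω j
  | some i, _ => P.g ω i / 2

/-- The Fourier transform of the forcing term, as a bilinear expression. -/
def forcingHat (u w : X P s) (o : Option ι) (ξ : V) : ℂ :=
  -Complex.I * ∑ j, (forcingSymbol P ((2 * π) • ξ) o j : ℂ) *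
    𝓕 (fun x => u.comp (forcingIndex o j) x * w.vel j x) ξ

theorem sobolevExponent_forcingIndex (o : Option ι) (j : ι) :
    sobolevExponent s (forcingIndex o j) = sobolevExponent s o := by
  cases o <;> rfl

theorem Symbols.IsAdmissible.abs_forcingSymbol_le (hP : P.IsAdmissible) (ω : V) (o : Option ι)
    (j : ι) : |forcingSymbol P ω o j| ≤ 1 := by
  cases o with
  | none => exact hP.abs_g_le ω j
  | some i =>
    simp only [forcingSymbol, abs_div, Nat.abs_ofNat]
    linarith [hP.abs_g_le ω i]

theorem Symbols.IsAdmissible.measurable_forcingSymbol (hP : P.IsAdmissible) (o : Option ι)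
    (j : ι) : Measurable fun ω => forcingSymbol P ω o j := by
  cases o with
  | none => exact hP.measurable_g j
  | some i => exact (hP.measurable_g i).div_const 2

theorem X.real_comp (u : X P s) (o : Option ι) : ∀ᵐ x, (u.comp o x).im = 0 := by
  cases o
  · exact u.memX.real_eta
  · exact u.memX.real_vel _

/-- The factor `-i` and the odd symbol `g` each change sign, the former under conjugation and the
latter under reflection; thus real functions are sent to real functions. -/
theorem forcingHat_neg (hP : P.IsAdmissible) (u w : X P s) (o : Option ι) (ξ : V) :
    forcingHat u w o (-ξ) = (starRingEnd ℂ) (forcingHat u w o ξ) := by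
  have h : ∀ j, forcingSymbol P ((2 * π) • -ξ) o j = -forcingSymbol P ((2 * π) • ξ) o j := by
    intro j
    cases o <;> simp [forcingSymbol, smul_neg, hP.g_neg, neg_div]
  have h' : ∀ j, 𝓕 (fun x => u.comp (forcingIndex o j) x * w.vel j x) (-ξ) =
      (starRingEnd ℂ) (𝓕 (fun x => u.comp (forcingIndex o j) x * w.vel j x) ξ) := fun j =>
    fourier_mul_neg (u.real_comp _) (w.real_comp (some j)) ξ
  simp only [forcingHat, h, h', map_mul, map_neg, Complex.conj_I, map_sum, Complex.conj_ofReal,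
    Complex.ofReal_neg, neg_mul, Finset.sum_neg_distrib, mul_neg, neg_neg]

/-- The velocity forcing is `g_j` times a scalar independent of `j`, and `g` is parallel to `e`;
this is the Fourier form of a gradient being curl free. -/
theorem forcingHat_curl (hP : P.IsAdmissible) (u w : X P s) (j k : ι) (ξ : V) :
    (P.e ((2 * π) • ξ) j : ℂ) * forcingHat u w (some k) ξ =
      (P.e ((2 * π) • ξ) k : ℂ) * forcingHat u w (some j) ξ := by
  have h := hP.e_mul_g ((2 * π) • ξ) j k
  have h' : (P.e ((2 * π) • ξ) j : ℂ) * (P.g ((2 * π) • ξ) k : ℂ) =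
    (P.e ((2 * π) • ξ) k : ℂ) * (P.g ((2 * π) • ξ) j : ℂ) := by exact_mod_cast h
  simp only [forcingHat, forcingSymbol, forcingIndex, ← Finset.mul_sum]
  push_cast
  linear_combination (-Complex.I * (∑ i, 𝓕 (fun x => u.comp (some i) x * w.vel i x) ξ) / 2) * h'

theorem aestronglyMeasurable_forcingHat (hP : P.IsAdmissible) (u w : X P s) (o : Option ι) :
    AEStronglyMeasurable (forcingHat u w o) volume := by
  refine aestronglyMeasurable_const.mul (Finset.aestronglyMeasurable_fun_sum _ fun j _ => ?_)
  exact (Complex.measurable_ofReal.comp ((hP.measurable_forcingSymbol o j).comp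
    (measurable_const_smul _))).aestronglyMeasurable.mul
    (continuous_fourier_mul _ _).aestronglyMeasurable

theorem X.eLpNorm_bracket_le (u : X P s) (o : Option ι) :
    eLpNorm (fun ξ : V => ((bracket (sobolevExponent s o) ((2 * π) • ξ) : ℝ) : ℂ) *
      hat (u.comp o) ξ) 2 volume ≤ ENNReal.ofReal (2 * ‖u‖) := by
  refine (eLpNorm_le_mul_eLpNorm_of_ae_le_mul (g := u.weighted o) (c := 2) ?_ 2).trans ?_
  · filter_upwards [u.coeFn_weighted o] with ξ h
    rw [h]
    simp only [norm_mul, Complex.norm_real, Real.norm_eq_abs, abs_of_pos (bracket_pos _ _),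
      abs_of_pos (normWeight_pos _ _)]
    rw [← mul_assoc]
    exact mul_le_mul_of_nonneg_right (bracket_le_normWeight o _) (norm_nonneg _)
  · rw [ENNReal.ofReal_mul (by norm_num), ← Lp.enorm_def, ← ofReal_norm]
    gcongr
    exact u.norm_weighted_le o

theorem X.norm_weighted_le_of_eLpNorm (u : X P s) (o : Option ι) {a : V → ℂ}
    (ha : hat (u.comp o) =ᵐ[volume] a) {C : ℝ} (hC : 0 ≤ C)
    (h : eLpNorm (fun ξ : V => ((bracket (sobolevExponent s o) ((2 * π) • ξ) : ℝ) : ℂ) * a ξ) 2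
      volume ≤ ENNReal.ofReal C) : ‖u.weighted o‖ ≤ 2 * C := by
  have h1 : eLpNorm (u.weighted o) 2 volume ≤ ENNReal.ofReal (2 * C) := by
    refine (eLpNorm_le_mul_eLpNorm_of_ae_le_mul (c := 2) (g := fun ξ : V =>
      ((bracket (sobolevExponent s o) ((2 * π) • ξ) : ℝ) : ℂ) * a ξ) ?_ 2).trans ?_
    · filter_upwards [u.coeFn_weighted o, ha] with ξ h1 h2
      rw [h1, h2]
      simp only [norm_mul, Complex.norm_real, Real.norm_eq_abs, abs_of_pos (bracket_pos _ _),
        abs_of_pos (normWeight_pos _ _)]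
      rw [← mul_assoc]
      exact mul_le_mul_of_nonneg_right (normWeight_le o _) (norm_nonneg _)
    · rw [ENNReal.ofReal_mul (by norm_num)]
      gcongr
  rw [Lp.norm_def]
  exact ENNReal.toReal_le_of_le_ofReal (by positivity) h1

theorem exists_eLpNorm_forcingHat_le (hP : P.IsAdmissible)
    (hs : (Module.finrank ℝ V : ℝ) < 2 * (s + 1 / 2)) :
    ∃ C : ℝ, 0 ≤ C ∧ ∀ (u w : X P s) (o : Option ι),
      eLpNorm (fun ξ : V => ((bracket (sobolevExponent s o) ((2 * π) • ξ) : ℝ) : ℂ) *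
        forcingHat u w o ξ) 2 volume ≤ ENNReal.ofReal (C * (‖u‖ * ‖w‖)) := by
  have hC : ∀ o : Option ι, ∃ C : ℝ≥0, ∀ f g : L2 V,
      eLpNorm (fun ξ => ((bracket (sobolevExponent s o) ((2 * π) • ξ) : ℝ) : ℂ) *
        𝓕 (fun x => f x * g x) ξ) 2 volume ≤
      C * (eLpNorm (fun ξ => ((bracket (sobolevExponent s o) ((2 * π) • ξ) : ℝ) : ℂ) *
        hat f ξ) 2 volume *
        eLpNorm (fun ξ => ((bracket (s + 1 / 2) ((2 * π) • ξ) : ℝ) : ℂ) * hat g ξ) 2 volume) :=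
    -- Here `σ = s + 1/2` is the regularity of the velocity factor, while `r` is `s` or `s + 1/2`
    -- according to the row.
    fun o => exists_eLpNorm_fourier_mul_le (sobolevExponent_nonneg o)
      (by cases o <;> simp only [sobolevExponent] <;> linarith) hs
  choose C hC using hC
  -- The `4` comes from comparing weights once for each factor; summing `C o` makes the constant
  -- uniform over the rows, and the cardinality counts the products in a row.
  refine ⟨Fintype.card ι * ((∑ o, (C o : ℝ)) * 4), by positivity, fun u w o => ?_⟩
  have hprod : ∀ j, eLpNorm (fun ξ : V =>
      ‖((bracket (sobolevExponent s o) ((2 * π) • ξ) : ℝ) : ℂ) *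
      𝓕 (fun x => u.comp (forcingIndex o j) x * w.vel j x) ξ‖) 2 volume ≤
      ENNReal.ofReal ((∑ o, (C o : ℝ)) * 4 * (‖u‖ * ‖w‖)) := by
    intro j
    have h1 := u.eLpNorm_bracket_le (forcingIndex o j)
    rw [sobolevExponent_forcingIndex] at h1
    have h2 := w.eLpNorm_bracket_le (some j)
    have h3 : (C o : ℝ) ≤ ∑ o, (C o : ℝ) :=
      Finset.single_le_sum (f := fun o => (C o : ℝ)) (fun _ _ => NNReal.coe_nonneg _)
        (Finset.mem_univ o)
    rw [eLpNorm_norm]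
    refine (hC o _ _).trans ((mul_le_mul_right (mul_le_mul' h1 h2) _).trans ?_)
    rw [← ENNReal.ofReal_mul (by positivity), ← ENNReal.ofReal_coe_nnreal,
      ← ENNReal.ofReal_mul (by positivity)]
    refine ENNReal.ofReal_le_ofReal ?_
    calc (C o : ℝ) * (2 * ‖u‖ * (2 * ‖w‖)) = (C o : ℝ) * 4 * (‖u‖ * ‖w‖) := by ring
      _ ≤ _ := by gcongr
  refine (eLpNorm_mono_real (g := ∑ j, fun ξ : V =>
      ‖((bracket (sobolevExponent s o) ((2 * π) • ξ) : ℝ) : ℂ) *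
      𝓕 (fun x => u.comp (forcingIndex o j) x * w.vel j x) ξ‖) fun ξ => ?_).trans
    ((eLpNorm_sum_le (fun j _ => ?_) (by norm_num)).trans
    ((Finset.sum_le_sum fun j _ => hprod j).trans (le_of_eq ?_)))
  · rw [Finset.sum_apply, forcingHat, norm_mul, norm_mul, norm_neg, Complex.norm_I, one_mul]
    simp only [norm_mul]
    rw [← Finset.mul_sum]
    gcongr
    refine (norm_sum_le _ _).trans (Finset.sum_le_sum fun j _ => ?_)
    rw [norm_mul, Complex.norm_real]
    exact mul_le_of_le_one_left (norm_nonneg _) (hP.abs_forcingSymbol_le _ _ _)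
  · exact ((Complex.measurable_ofReal.comp ((measurable_bracket _).comp
      (measurable_const_smul _))).aestronglyMeasurable.mul
      (continuous_fourier_mul _ _).aestronglyMeasurable).norm
  · rw [Finset.sum_const, nsmul_eq_mul, Finset.card_univ, ← ENNReal.ofReal_natCast,
      ← ENNReal.ofReal_mul (by positivity)]
    congr 1; ring

theorem X.ext_hat {u w : X P s} (h : ∀ o, hat (u.comp o) =ᵐ[volume] hat (w.comp o)) : u = w :=
  X.weighted_injective fun o => Lp.ext (by
    filter_upwards [u.coeFn_weighted o, w.coeFn_weighted o, h o] with ξ h1 h2 h3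
    rw [h1, h2, h3])

theorem X.comp_some (u : X P s) (j : ι) : u.comp (some j) = u.vel j := rfl

theorem forcingHat_add_left (u u' w : X P s) (o : Option ι) (ξ : V) :
    forcingHat (u + u') w o ξ = forcingHat u w o ξ + forcingHat u' w o ξ := by
  simp only [forcingHat, X.comp_add, fourier_mul_add_left, mul_add, Finset.sum_add_distrib]

theorem forcingHat_add_right (u w w' : X P s) (o : Option ι) (ξ : V) :
    forcingHat u (w + w') o ξ = forcingHat u w o ξ + forcingHat u w' o ξ := by
  simp only [forcingHat, ← X.comp_some, X.comp_add, fourier_mul_add_right, mul_add,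
    Finset.sum_add_distrib]

theorem forcingHat_smul_left (c : ℝ) (u w : X P s) (o : Option ι) (ξ : V) :
    forcingHat (c • u) w o ξ = c * forcingHat u w o ξ := by
  simp only [forcingHat, X.comp_smul, fourier_mul_smul_left, mul_left_comm _ (c : ℂ),
    ← Finset.mul_sum]

theorem forcingHat_smul_right (c : ℝ) (u w : X P s) (o : Option ι) (ξ : V) :
    forcingHat u (c • w) o ξ = c * forcingHat u w o ξ := by
  simp only [forcingHat, ← X.comp_some, X.comp_smul, fourier_mul_smul_right,
    mul_left_comm _ (c : ℂ), ← Finset.mul_sum]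

theorem X.hat_comp_add (u w : X P s) (o : Option ι) :
    hat ((u + w).comp o) =ᵐ[volume] fun ξ => hat (u.comp o) ξ + hat (w.comp o) ξ := by
  rw [X.comp_add]; exact hat_add _ _

theorem X.hat_comp_smul (c : ℝ) (u : X P s) (o : Option ι) :
    hat ((c • u).comp o) =ᵐ[volume] fun ξ => (c : ℂ) * hat (u.comp o) ξ := by
  rw [X.comp_smul]; exact hat_smul _ _

/-- The forcing term is a bounded bilinear map of `X^s`. -/
theorem exists_forcing (hP : P.IsAdmissible)
    (hs : (Module.finrank ℝ V : ℝ) < 2 * (s + 1 / 2)) :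
    ∃ B : X P s →L[ℝ] X P s →L[ℝ] X P s,
      ∀ u w o, hat ((B u w).comp o) =ᵐ[volume] forcingHat u w o := by
  obtain ⟨C, hC0, hC⟩ := exists_eLpNorm_forcingHat_le (s := s) hP hs
  have hex : ∀ u w : X P s, ∃ F : X P s, ∀ o, hat (F.comp o) =ᵐ[volume] forcingHat u w o :=
    fun u w => X.exists_hat_eq (fun o => forcingHat u w o)
      (aestronglyMeasurable_forcingHat hP u w)
      (fun o => ⟨(Complex.measurable_ofReal.comp ((measurable_bracket _).comp
        (measurable_const_smul _))).aestronglyMeasurable.mul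
        (aestronglyMeasurable_forcingHat hP u w o),
        (hC u w o).trans_lt ENNReal.ofReal_lt_top⟩)
      (fun o => .of_forall fun ξ => forcingHat_neg hP u w o ξ)
      (fun j k => .of_forall fun ξ => forcingHat_curl hP u w j k ξ)
  choose F hF using hex
  refine ⟨LinearMap.mkContinuous₂ (LinearMap.mk₂ ℝ F
    (fun u u' w => X.ext_hat fun o => ?_) (fun c u w => X.ext_hat fun o => ?_)
    (fun u w w' => X.ext_hat fun o => ?_) (fun c u w => X.ext_hat fun o => ?_))
    (Fintype.card (Option ι) * (2 * C)) fun u w => ?_, hF⟩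
  · filter_upwards [hF (u + u') w o, hF u w o, hF u' w o, X.hat_comp_add (F u w) (F u' w) o]
      with ξ h1 h2 h3 h4
    rw [h1, h4, h2, h3, forcingHat_add_left]
  · filter_upwards [hF (c • u) w o, hF u w o, X.hat_comp_smul c (F u w) o] with ξ h1 h2 h3
    rw [h1, h3, h2, forcingHat_smul_left]
  · filter_upwards [hF u (w + w') o, hF u w o, hF u w' o, X.hat_comp_add (F u w) (F u w') o]
      with ξ h1 h2 h3 h4
    rw [h1, h4, h2, h3, forcingHat_add_right]
  · filter_upwards [hF u (c • w) o, hF u w o, X.hat_comp_smul c (F u w) o] with ξ h1 h2 h3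
    rw [h1, h3, h2, forcingHat_smul_right]
  · rw [LinearMap.mk₂_apply]
    refine (F u w).norm_le_sum.trans ((Finset.sum_le_sum (g := fun _ =>
      2 * (C * (‖u‖ * ‖w‖))) fun o _ => (F u w).norm_weighted_le_of_eLpNorm o (hF u w o)
        (by positivity) (hC u w o)).trans (le_of_eq ?_))
    rw [Finset.sum_const, nsmul_eq_mul, Finset.card_univ]
    ring

/-- An element of `X^s` is determined by its Fourier transform, so the forcing term of `u` is unique
and equals the diagonal value of `B`. The half in `|v|²/2` was placed in the symbol of `B`. -/
theorem isForcing_iff {B : X P s →L[ℝ] X P s →L[ℝ] X P s}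
    (hB : ∀ u w o, hat ((B u w).comp o) =ᵐ[volume] forcingHat u w o) (u F : X P s) :
    IsForcing u F ↔ F = B u u := by
  have e1 : ∀ ξ : V, forcingHat u u none ξ = -Complex.I * ∑ j, (P.g ((2 * π) • ξ) j : ℂ) *
      𝓕 (fun x => u.eta x * u.vel j x) ξ := fun ξ => rfl
  have e2 : ∀ j (ξ : V), forcingHat u u (some j) ξ = -Complex.I * (P.g ((2 * π) • ξ) j : ℂ) *
      𝓕 (fun x => (∑ k, u.vel k x ^ 2) / 2) ξ := by
    intro j ξ
    have h : 𝓕 (fun x => (∑ k, u.vel k x ^ 2) / 2) ξ =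
        (∑ k, 𝓕 (fun x => u.vel k x * u.vel k x) ξ) / 2 := by
      simp only [Real.fourier_eq]
      -- Splitting the transform of `|v|²` into its summands is legitimate because each `v_k²` is
      -- integrable.
      rw [← integral_finsetSum, ← integral_div]
      · congr 1
        ext x
        simp only [Circle.smul_def, smul_eq_mul, ← Finset.mul_sum, sq, mul_div_assoc]
      · intro k _
        exact (Real.fourierIntegral_convergent_iff ξ).2 (integrable_mul_L2 (u.vel k) (u.vel k))
    rw [h]
    simp only [forcingHat, forcingSymbol, forcingIndex, X.comp_some, ← Finset.mul_sum]
    push_cast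
    ring
  constructor
  · rintro ⟨h1, h2⟩
    refine X.ext_hat fun o => ?_
    cases o with
    | none =>
      filter_upwards [h1, hB u u none] with ξ h3 h4
      rw [h4, e1]; exact h3
    | some j =>
      filter_upwards [h2 j, hB u u (some j)] with ξ h3 h4
      rw [h4, e2]; exact h3
  · rintro rfl
    refine ⟨?_, fun j => ?_⟩
    · filter_upwards [hB u u none] with ξ h4
      rw [← e1]; exact h4
    · filter_upwards [hB u u (some j)] with ξ h4
      rw [← e2]; exact h4

end

/-! ### Well-posedness for admissible symbols -/

section
set_option linter.unusedSectionVars false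
open Filter Topology Set
variable {V : Type} [NormedAddCommGroup V] [InnerProductSpace ℝ V] [FiniteDimensional ℝ V]
  [MeasurableSpace V] [BorelSpace V] {ι : Type} [Fintype ι] {P : Symbols V ι} {s : ℝ≥0}

/-- The curve `F` is forced on `[0, T]` to be `B(u, u)`, and only its values there enter the
integral. Hence the relation is the graph of the map `u ↦ L u₀ + Q(u, u)`, which is the
well-definedness of `𝒜`. -/
theorem isDuhamelImage_iff {B : X P s →L[ℝ] X P s →L[ℝ] X P s}
    (hB : ∀ u w o, hat ((B u w).comp o) =ᵐ[volume] forcingHat u w o) {T : ℝ} (hT : 0 ≤ T)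
    (u₀ : X P s) (u w : C(Icc (0 : ℝ) T, X P s)) :
    IsDuhamelImage T u₀ u w ↔
      w = freeFlow T X.norm_propagator_le X.continuous_propagator u₀ +
        duhamel hT X.norm_propagator_le X.continuous_propagator B u u := by
  constructor
  · rintro ⟨F, -, hF⟩
    ext t : 1
    rw [(hF t).2, ContinuousMap.add_apply, duhamel_apply, freeFlow_apply, X.propagator_apply]
    congr 1
    refine intervalIntegral.integral_congr fun x hx => ?_
    rw [uIcc_of_le t.2.1] at hx
    have hx' : x ∈ Icc (0 : ℝ) T := ⟨hx.1, hx.2.trans t.2.2⟩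
    simp only [projIcc_of_mem hT hx', X.propagator_apply,
      (isForcing_iff hB _ _).1 (hF ⟨x, hx'⟩).1]
  · rintro rfl
    refine ⟨fun t => B (u (projIcc 0 T hT t)) (u (projIcc 0 T hT t)),
      (continuous_bilinear_extend hT B u u).continuousOn, fun t => ⟨?_, rfl⟩⟩
    simp only [isForcing_iff hB, projIcc_val]

theorem wellPosed (hP : P.IsAdmissible) (hs : (Module.finrank ℝ V : ℝ) < 2 * (s + 1 / 2)) :
    (∀ T : ℝ, 0 < T → ∀ (u₀ : X P s) (u : C(Icc (0 : ℝ) T, X P s)),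
      ∃! w : C(Icc (0 : ℝ) T, X P s), IsDuhamelImage T u₀ u w) ∧
    (∃ C : ℝ, 0 < C ∧ ∀ (u₀ : X P s) (T : ℝ), 0 < T → 7 * C * ‖u₀‖ * T ≤ 1 →
      ∃! u : C(Icc (0 : ℝ) T, X P s), IsDuhamelImage T u₀ u u) ∧
    (∀ R : ℝ, 0 < R → ∃ T : ℝ, 0 < T ∧ ∃ Φ : X P s → C(Icc (0 : ℝ) T, X P s),
      (∀ u₀ ∈ Metric.ball (0 : X P s) R, ∀ u : C(Icc (0 : ℝ) T, X P s),
        IsDuhamelImage T u₀ u u ↔ u = Φ u₀) ∧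
      AnalyticOnNhd ℝ Φ (Metric.ball (0 : X P s) R)) := by
  obtain ⟨B, hB⟩ := exists_forcing (s := s) hP hs
  set M : ℝ := (Fintype.card (Option ι)) ^ 2 with hM
  have hM0 : 0 ≤ M := by positivity
  -- Contraction yields a solution with a norm bound, and Gronwall excludes every other solution,
  -- including those outside the contraction ball.
  have hsol : ∀ (u₀ : X P s) {T : ℝ} (hT : 0 ≤ T), 8 * (M * ‖B‖ * T) * (M * ‖u₀‖) ≤ 1 →
      ∃ z : C(Icc (0 : ℝ) T, X P s), ‖z‖ ≤ 2 * (M * ‖u₀‖) ∧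
        ∀ w : C(Icc (0 : ℝ) T, X P s), IsDuhamelImage T u₀ w w ↔ w = z := by
    intro u₀ T hT h
    obtain ⟨z, hz, hfix⟩ := exists_quadratic_fixedPoint _ _ (by positivity)
      (norm_duhamel_apply_le hT X.norm_propagator_le X.continuous_propagator B)
      (norm_freeFlow_le T X.norm_propagator_le X.continuous_propagator u₀) h
    refine ⟨z, hz, fun w => ?_⟩
    rw [isDuhamelImage_iff hB hT]
    refine ⟨fun hw => duhamel_unique hT _ _ B hw hfix, ?_⟩
    rintro rfl
    exact hfix
  -- Since `7 (2 M² ‖B‖ + 1) ≥ 8 M² ‖B‖`, the hypothesis with this constant implies the contraction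
  -- condition; the summand `1` ensures positivity even if `B = 0`.
  refine ⟨fun T hT u₀ u => ?_, ⟨2 * M ^ 2 * ‖B‖ + 1, by positivity, fun u₀ T hT h => ?_⟩,
    fun R hR => ?_⟩
  · simp only [isDuhamelImage_iff hB hT.le]
    exact existsUnique_eq
  · obtain ⟨z, -, hz⟩ := hsol u₀ hT.le (by
      have : 0 ≤ (6 * M ^ 2 * ‖B‖ + 7) * ‖u₀‖ * T := by positivity
      nlinarith)
    simp only [hz]
    exact existsUnique_eq
  -- The summand `1` keeps the inverse meaningful when `B = 0` and makes `8 M² ‖B‖ R T < 1` strict.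
  · set T : ℝ := (8 * M ^ 2 * ‖B‖ * R + 1)⁻¹ with hTdef
    have hT : 0 < T := by positivity
    have hTR : 8 * M ^ 2 * ‖B‖ * R * T < 1 := by
      rw [hTdef, ← div_eq_mul_inv, div_lt_one (by positivity)]
      linarith
    have hball : ∀ u₀ ∈ Metric.ball (0 : X P s) R,
        8 * (M * ‖B‖ * T) * (M * ‖u₀‖) < 1 := fun u₀ hu₀ => by
      rw [mem_ball_zero_iff] at hu₀
      refine lt_of_le_of_lt ?_ hTR
      calc 8 * (M * ‖B‖ * T) * (M * ‖u₀‖) = 8 * M ^ 2 * ‖B‖ * ‖u₀‖ * T := by ring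
        _ ≤ _ := by gcongr
    choose! Φ hΦ using fun (u₀ : X P s) (hu₀ : u₀ ∈ Metric.ball (0 : X P s) R) =>
      hsol u₀ hT.le (hball u₀ hu₀).le
    refine ⟨T, hT, Φ, fun u₀ hu₀ => (hΦ u₀ hu₀).2, ?_⟩
    refine analyticOnNhd_quadratic_fixedPoint
      (duhamel hT.le X.norm_propagator_le X.continuous_propagator B)
      (freeFlow T X.norm_propagator_le X.continuous_propagator) Metric.isOpen_ball
      (q := M * ‖B‖ * T) (by positivity)
      (norm_duhamel_apply_le hT.le X.norm_propagator_le X.continuous_propagator B)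
      (fun u₀ hu₀ z => ?_) (fun u₀ hu₀ => ?_)
    · rw [← isDuhamelImage_iff hB hT.le, (hΦ u₀ hu₀).2]
    · have h1 := (hΦ u₀ hu₀).1
      have h2 := hball u₀ hu₀
      -- With `q = M ‖B‖ T`, the bound `‖Φ u₀‖ ≤ 2 M ‖u₀‖` gives `2 q ‖Φ u₀‖ ≤ 4 q M ‖u₀‖ < 1/2`,
      -- which suffices for the derivative to be invertible.
      have h3 : 2 * (M * ‖B‖ * T) * ‖Φ u₀‖ ≤ 2 * (M * ‖B‖ * T) * (2 * (M * ‖u₀‖)) := by gcongr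
      have h4 : 0 ≤ (M * ‖B‖ * T) * (M * ‖u₀‖) := by positivity
      linarith

end

/-! ### Admissibility of the symbols on the line and on the plane -/

theorem isAdmissible_line : line.IsAdmissible where
  measurable_g _ := measurable_tanh
  abs_g_le ω _ := (Real.abs_tanh_lt_one ω).le
  g_neg ω _ := Real.tanh_neg ω
  e_mul_g _ _ _ := rfl

/-- Away from the origin `K² |ω|` is `tanh |ω|`: the smoothing of `K²` compensates exactly the
derivative in the nonlinearity of the planar system. -/
theorem symK_sq_mul_norm_le {V : Type} [NormedAddCommGroup V] [InnerProductSpace ℝ V] (ω : V) :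
    symK ω ^ 2 * ‖ω‖ ≤ 1 := by
  unfold symK
  split_ifs with h
  · simp [h]
  · have hn : 0 < ‖ω‖ := lt_of_le_of_ne (norm_nonneg ω) (Ne.symm h)
    have ht : 0 ≤ Real.tanh ‖ω‖ := by
      by_contra hc
      nlinarith [le_tanh hn.le]
    rw [Real.sq_sqrt (by positivity), div_mul_cancel₀ _ h]
    exact (Real.tanh_lt_one _).le

theorem isAdmissible_plane : plane.IsAdmissible where
  measurable_g j := (measurable_symK.pow_const 2).mul (by fun_prop)
  abs_g_le ω j := by
    have h : |ω j| ≤ ‖ω‖ := by simpa using PiLp.norm_apply_le ω j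
    simp only [plane, abs_mul, abs_pow, sq_abs]
    exact (mul_le_mul_of_nonneg_left h (sq_nonneg _)).trans (symK_sq_mul_norm_le ω)
  g_neg ω j := by simp [plane, symK_neg]
  e_mul_g ω j k := by simp only [plane]; ring

end
end WhithamBoussinesq

theorem mainTheorem7 :
    (∀ s : ℝ≥0, 0 < s →
      -- the map `𝒜 : X^s_T → X^s_T` is well defined
      (∀ T : ℝ, 0 < T → ∀ (u₀ : X line s) (u : C(Set.Icc (0 : ℝ) T, X line s)),
        ∃! w : C(Set.Icc (0 : ℝ) T, X line s), IsDuhamelImage T u₀ u w) ∧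
      -- local existence and uniqueness
      (∃ C : ℝ, 0 < C ∧ ∀ (u₀ : X line s) (T : ℝ), 0 < T → 7 * C * ‖u₀‖ * T ≤ 1 →
        ∃! u : C(Set.Icc (0 : ℝ) T, X line s), IsDuhamelImage T u₀ u u) ∧
      -- analyticity of the flow map
      (∀ R : ℝ, 0 < R → ∃ T : ℝ, 0 < T ∧ ∃ Φ : X line s → C(Set.Icc (0 : ℝ) T, X line s),
        (∀ u₀ ∈ Metric.ball (0 : X line s) R, ∀ u : C(Set.Icc (0 : ℝ) T, X line s),
          IsDuhamelImage T u₀ u u ↔ u = Φ u₀) ∧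
        AnalyticOnNhd ℝ Φ (Metric.ball (0 : X line s) R))) ∧
    (∀ s : ℝ≥0, 1 / 2 < s →
      -- the map `𝒜 : X^s_T → X^s_T` is well defined
      (∀ T : ℝ, 0 < T → ∀ (u₀ : X plane s) (u : C(Set.Icc (0 : ℝ) T, X plane s)),
        ∃! w : C(Set.Icc (0 : ℝ) T, X plane s), IsDuhamelImage T u₀ u w) ∧
      -- local existence and uniqueness
      (∃ C : ℝ, 0 < C ∧ ∀ (u₀ : X plane s) (T : ℝ), 0 < T → 7 * C * ‖u₀‖ * T ≤ 1 →
        ∃! u : C(Set.Icc (0 : ℝ) T, X plane s), IsDuhamelImage T u₀ u u) ∧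
      -- analyticity of the flow map
      (∀ R : ℝ, 0 < R → ∃ T : ℝ, 0 < T ∧ ∃ Φ : X plane s → C(Set.Icc (0 : ℝ) T, X plane s),
        (∀ u₀ ∈ Metric.ball (0 : X plane s) R, ∀ u : C(Set.Icc (0 : ℝ) T, X plane s),
          IsDuhamelImage T u₀ u u ↔ u = Φ u₀) ∧
        AnalyticOnNhd ℝ Φ (Metric.ball (0 : X plane s) R))) :=
  ⟨fun s hs => wellPosed isAdmissible_line (by
      -- In dimension one the condition `1 < 2 (s + 1/2)` is `s > 0`; on the plane `2 < 2 (s + 1/2)`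
      -- is `s > 1/2`.
      have : (0 : ℝ) < s := hs
      simp
      linarith),
    fun s hs => wellPosed isAdmissible_plane (by
      have : (1 / 2 : ℝ) < s := by exact_mod_cast hs
      simp
      linarith)⟩
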